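/- Notation. $L^p=L^p(\mathbb R^3;\mathbb C)$, $H^2=W^{2,2}(\mathbb R^3;\mathbb C)$ (weak derivatives up to order two in $L^2$), and for $\boldsymbol\psi=(\psi_1,\dots,\psi_N):\mathbb R^3\to\mathbb C^N$, $|\boldsymbol\psi|^2=\sum_{j=1}^N|\psi_j|^2$, $$\|\boldsymbol\psi\|_{(L^p)^N}=\big\|\,|\boldsymbol\psi|\,\big\|_{L^p},\qquad \|\psi_j\|_{H^2}^2=\|\psi_j\|_{L^2}^2+\|\Delta\psi_j\|_{L^2}^2,\qquad \|\boldsymbol\psi\|_{(H^2)^N}^2=\sum_{j=1}^N\|\psi_j\|_{H^2}^2 .$$ For $q\ge 1$ and $\lambda\in\mathbb R$ write $F_{q,\lambda}(\boldsymbol\psi)=\lambda\rho^{q-1}\boldsymbol\psi=\lambda|\boldsymbol\psi|^{2(q-1)}\boldsymbol\psi$, where $\rho=|\boldsymbol\psi|^2$ (with $0^0=1$). Lemma (Lipschitz estimates on the local non-linearity). (D) Let $q\in[1,\infty)$ and $\lambda\in\mathbb R$. There is a constant $0<C_{q,\lambda}<\infty$, depending only on $q$ and $\lambda$, such that for all $N$,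 all $p\in[1,\infty]$ and all $\boldsymbol\psi,\boldsymbol\psi'\in(H^2)^N\cap(L^p)^N$ we have $F_{q,\lambda}(\boldsymbol\psi),F_{q,\lambda}(\boldsymbol\psi')\in(L^p)^N$ and $$\|F_{q,\lambda}(\boldsymbol\psi)-F_{q,\lambda}(\boldsymbol\psi')\|_{(L^p)^N}\le C_{q,\lambda}\,N^{\max\{q-2,0\}}\sum_{j=1}^N\Big[\|\psi_j\|_{H^2}^{2(q-1)}+\|\psi'_j\|_{H^2}^{2(q-1)}\Big]\,\|\boldsymbol\psi-\boldsymbol\psi'\|_{(L^p)^N}.$$ (E) Let $q\ge 7/2$ and $\lambda\in\mathbb R$. There is a non-decreasing function $\mathcal L_{q,\lambda}:[0,\infty)\to[0,\infty)$, which vanishes at the origin and only there, such that for all $N$ and all $\boldsymbol\psi,\boldsymbol\psi'\in(H^2)^N$ we have $F_{q,\lambda}(\boldsymbol\psi),F_{q,\lambda}(\boldsymbol\psi')\in(H^2)^N$ and $$\|F_{q,\lambda}(\boldsymbol\psi)-F_{q,\lambda}(\boldsymbol\psi')\|_{(H^2)^N}\le \mathcal L_{q,\lambda}\big(\max\{\|\boldsymbol\psi\|_{(H^2)^N},\|\boldsymbol\psi'\|_{(H^2)^N}\}\big)\,\|\boldsymbol\psi-\boldsymbol\psi'\|_{(H^2)^N}.$$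 -/

import Mathlib

open MeasureTheory
open scoped ENNReal

noncomputable section

/-- Physical space `ℝ³` with its Euclidean norm (and Lebesgue measure `volume`). -/
abbrev R3 : Type := EuclideanSpace ℝ (Fin 3)

/-- Test functions on `ℝ³`: real-valued, smooth and compactly supported. -/
def IsTestFunction (φ : R3 → ℝ) : Prop :=
  ContDiff ℝ (⊤ : ℕ∞) φ ∧ HasCompactSupport φ

/-- `g` is the weak partial derivative `∂ᵢ f`: both are locally integrable and
`∫ (∂ᵢ φ) f = - ∫ φ g` for all test functions `φ`. -/
def IsWeakPartial (i : Fin 3) (f g : R3 → ℂ) : Prop :=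
  LocallyIntegrable f ∧ LocallyIntegrable g ∧
    ∀ φ : R3 → ℝ, IsTestFunction φ →
      ∫ x, (fderiv ℝ φ x (EuclideanSpace.single i 1)) • f x = - ∫ x, φ x • g x

/-- `g` is the weak Laplacian `Δ f`: both are locally integrable and
`∫ (Δ φ) f = ∫ φ g` for all test functions `φ`. -/
def IsWeakLaplacian (f g : R3 → ℂ) : Prop :=
  LocallyIntegrable f ∧ LocallyIntegrable g ∧
    ∀ φ : R3 → ℝ, IsTestFunction φ →
      ∫ x, (Laplacian.laplacian φ x) • f x = ∫ x, φ x • g x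

open Classical in
/-- A representative of the weak Laplacian of `f` (unique up to null sets), and `0` if `f` has
no weak Laplacian. -/
def weakLaplacian (f : R3 → ℂ) : R3 → ℂ :=
  if h : ∃ g, IsWeakLaplacian f g then h.choose else 0

/-- `f ∈ H² = W^{2,2}(ℝ³; ℂ)`: `f` and all its weak partial derivatives of first and second
order are in `L²`. -/
def MemH2 (f : R3 → ℂ) : Prop :=
  MemLp f 2 ∧
    ∃ (g : Fin 3 → R3 → ℂ) (h : Fin 3 → Fin 3 → R3 → ℂ),
      (∀ i, MemLp (g i) 2 ∧ IsWeakPartial i f (g i)) ∧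
      (∀ i j, MemLp (h i j) 2 ∧ IsWeakPartial j (g i) (h i j))

/-- The norm of `(L^p)^N`, i.e. the `L^p` norm of the pointwise Euclidean norm
(meaningful on functions with `MemLp ψ p`). -/
def normLp {N : ℕ} (p : ℝ≥0∞) (ψ : R3 → EuclideanSpace ℂ (Fin N)) : ℝ :=
  (eLpNorm ψ p volume).toReal

/-- The norm `‖f‖_{H²} = (‖f‖_{L²}² + ‖Δf‖_{L²}²)^{1/2}` (meaningful on functions with
`MemH2 f`). -/
def normH2 (f : R3 → ℂ) : ℝ :=
  Real.sqrt ((eLpNorm f 2 volume).toReal ^ 2 + (eLpNorm (weakLaplacian f) 2 volume).toReal ^ 2)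

/-- `ψ ∈ (H²)^N`. -/
def MemH2Vec {N : ℕ} (ψ : R3 → EuclideanSpace ℂ (Fin N)) : Prop :=
  ∀ j, MemH2 (fun x => ψ x j)

/-- The norm `‖ψ‖_{(H²)^N} = (∑ⱼ ‖ψⱼ‖_{H²}²)^{1/2}`. -/
def normH2Vec {N : ℕ} (ψ : R3 → EuclideanSpace ℂ (Fin N)) : ℝ :=
  Real.sqrt (∑ j, normH2 (fun x => ψ x j) ^ 2)

/-- The density `ρ = ∑ⱼ |ψⱼ|²`. -/
def density {N : ℕ} (ψ : R3 → EuclideanSpace ℂ (Fin N)) (x : R3) : ℝ :=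
  ∑ j, ‖ψ x j‖ ^ 2

/-- The local exchange potential `v_x[ρ] = λ ρ^{q-1}`. -/
def exchangePotential (q lam : ℝ) (ρ : R3 → ℝ) (x : R3) : ℝ :=
  lam * ρ x ^ (q - 1)

/-- The local non-linearity `ψ ↦ v_x[ρ] ψ = λ |ψ|^{2(q-1)} ψ`. -/
def localNonlinearity {N : ℕ} (q lam : ℝ) (ψ : R3 → EuclideanSpace ℂ (Fin N)) :
    R3 → EuclideanSpace ℂ (Fin N) :=
  fun x => exchangePotential q lam (density ψ) x • ψ x

end

/-!
In dimension at most three the resolvent symbol `(1 + |ξ|²)⁻¹` is square integrable, so `H²` embeds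
in `L^∞`; an integration by parts then puts the gradient of an `H²` function in `L⁴`. The
non-linearity is `λ` times `z ↦ |z|^b z` with `b = 2 (q - 1)`. Its pointwise Lipschitz bound with
constant `~ |z|^b + |w|^b` gives the `L^p` estimate, once `|ψ|^b` is bounded by the `H²` norms of
the components; the power of `N` is the price of distributing a power over a sum. For `b ≥ 2` the
map is of class `C²` with locally Lipschitz second derivative `F''`, and the chain rule
`∂ᵢ∂ⱼ F(ψ) = F'(ψ) ∂ᵢ∂ⱼψ + F''(ψ)(∂ᵢψ, ∂ⱼψ)` reduces the `H²` estimate to Hölder's inequality in the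
forms `L^∞ · L²` and `L^∞ · L⁴ · L⁴`. The chain rule itself passes to `H²` from Schwartz functions
by density, the estimate being what makes the composition converge.
-/

section L2LineDeriv

open Filter Topology
open scoped SchwartzMap LineDeriv FourierTransform Real

theorem hasLineDerivAt_schwartz {E V : Type*} [NormedAddCommGroup E] [NormedSpace ℝ E]
    [NormedAddCommGroup V] [NormedSpace ℝ V] (f : 𝓢(E, V)) (x v : E) :
    HasLineDerivAt ℝ f ((∂_{v} f) x) x v := by
  simpa only [SchwartzMap.lineDerivOp_apply_eq_fderiv] using (f.hasFDerivAt x).hasLineDerivAt v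

variable {E V W : Type*} [NormedAddCommGroup E] [InnerProductSpace ℝ E] [FiniteDimensional ℝ E]
  [MeasurableSpace E] [BorelSpace E]
  [NormedAddCommGroup V] [InnerProductSpace ℂ V]

theorem integrable_schwartz_smul (φ : 𝓢(E, ℂ)) {f : E → V} (hf : MemLp f 2) :
    Integrable (fun x => φ x • f x) :=
  memLp_one_iff_integrable.1 (hf.smul (φ.memLp 2))

/-- `g` is the distributional derivative of `f` along `v`, both functions being in `L²`. It is
tested against complex Schwartz functions, so that it is the derivative of `f` as a tempered
distribution. -/
structure HasL2LineDeriv (v : E) (f g : E → V) : Prop where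
  memLp : MemLp f 2
  memLp_deriv : MemLp g 2
  integral_lineDeriv_smul : ∀ φ : 𝓢(E, ℂ), ∫ x, (∂_{v} φ) x • f x = -∫ x, φ x • g x

theorem HasL2LineDeriv.of_hasLineDerivAt {v : E} {f g : E → V} (hf : MemLp f 2) (hg : MemLp g 2)
    (h : ∀ x, HasLineDerivAt ℝ f (g x) x v) : HasL2LineDeriv v f g := by
  refine ⟨hf, hg, fun φ => ?_⟩
  have parts := integral_bilinear_hasLineDerivAt_right_eq_neg_left_of_integrable
    (μ := volume) (f := φ) (f' := (∂_{v} φ : 𝓢(E, ℂ))) (B := ContinuousLinearMap.lsmul ℝ ℂ)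
    (integrable_schwartz_smul _ hf) (integrable_schwartz_smul _ hg)
    (integrable_schwartz_smul _ hf) (fun x _ => hasLineDerivAt_schwartz φ x v)
    (fun x _ => h x)
  simp only [ContinuousLinearMap.lsmul_apply] at parts
  rw [parts, neg_neg]

theorem hasL2LineDeriv_schwartz (v : E) (f : 𝓢(E, V)) :
    HasL2LineDeriv v f (∂_{v} f : 𝓢(E, V)) :=
  .of_hasLineDerivAt (f.memLp 2) ((∂_{v} f : 𝓢(E, V)).memLp 2) fun x =>
    hasLineDerivAt_schwartz f x v

theorem HasL2LineDeriv.sub {v : E} {f f' g g' : E → V} (h : HasL2LineDeriv v f g)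
    (h' : HasL2LineDeriv v f' g') : HasL2LineDeriv v (f - f') (g - g') := by
  refine ⟨h.memLp.sub h'.memLp, h.memLp_deriv.sub h'.memLp_deriv, fun φ => ?_⟩
  simp only [Pi.sub_apply, smul_sub]
  rw [integral_sub (integrable_schwartz_smul _ h.memLp) (integrable_schwartz_smul _ h'.memLp),
    integral_sub (integrable_schwartz_smul _ h.memLp_deriv)
      (integrable_schwartz_smul _ h'.memLp_deriv),
    h.integral_lineDeriv_smul, h'.integral_lineDeriv_smul, neg_sub_neg, neg_sub]

theorem tendsto_toLp_iff_lpNorm_sub {ι G : Type*} [NormedAddCommGroup G] {α : Type*}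
    [MeasurableSpace α] {μ : Measure α} {p : ℝ≥0∞} [Fact (1 ≤ p)] {l : Filter ι}
    {F : ι → α → G} {f : α → G} (hF : ∀ n, MemLp (F n) p μ) (hf : MemLp f p μ) :
    Tendsto (fun n => (hF n).toLp (F n)) l (𝓝 (hf.toLp f)) ↔
      Tendsto (fun n => lpNorm (F n - f) p μ) l (𝓝 0) := by
  rw [tendsto_iff_norm_sub_tendsto_zero]
  refine tendsto_congr fun n => ?_
  rw [← MemLp.toLp_sub, Lp.norm_toLp, toReal_eLpNorm ((hF n).sub hf).1]

theorem exists_schwartz_tendsto_lpNorm_sub {p : ℝ≥0∞} [Fact (1 ≤ p)] (hp : p ≠ ⊤) {f : E → V}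
    (hf : MemLp f p) :
    ∃ F : ℕ → 𝓢(E, V), Tendsto (fun n => lpNorm (⇑(F n) - f) p volume) atTop (𝓝 0) := by
  obtain ⟨s, hs, hsf⟩ := mem_closure_iff_seq_limit.1
    (SchwartzMap.denseRange_toLpCLM (E := E) (F := V) (μ := volume) hp (hf.toLp f))
  choose F hF using hs
  refine ⟨F, (tendsto_toLp_iff_lpNorm_sub (fun n => (F n).memLp p volume) hf).1 ?_⟩
  exact hsf.congr fun n => (hF n).symm

variable [CompleteSpace V]

/-- The tempered distribution defined by an `L²` function. -/
noncomputable def l2Distribution {f : E → V} (hf : MemLp f 2) : 𝓢'(E, V) :=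
  Lp.toTemperedDistribution (hf.toLp f)

theorem l2Distribution_apply {f : E → V} (hf : MemLp f 2) (φ : 𝓢(E, ℂ)) :
    l2Distribution hf φ = ∫ x, φ x • f x := by
  rw [l2Distribution, Lp.toTemperedDistribution_apply]
  refine integral_congr_ae ?_
  filter_upwards [hf.coeFn_toLp] with x hx
  rw [hx]

theorem l2Distribution_sub {f g : E → V} (hf : MemLp f 2) (hg : MemLp g 2) :
    l2Distribution (hf.sub hg) = l2Distribution hf - l2Distribution hg := by
  ext φ
  simp only [l2Distribution_apply, _root_.sub_apply, Pi.sub_apply, smul_sub]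
  exact integral_sub (integrable_schwartz_smul φ hf) (integrable_schwartz_smul φ hg)

theorem hasL2LineDeriv_iff {v : E} {f g : E → V} (hf : MemLp f 2) (hg : MemLp g 2) :
    HasL2LineDeriv v f g ↔ ∂_{v} (l2Distribution hf) = l2Distribution hg := by
  have lineDeriv_apply (φ : 𝓢(E, ℂ)) :
      (∂_{v} (l2Distribution hf)) φ = -∫ x, (∂_{v} φ) x • f x := by
    rw [TemperedDistribution.lineDerivOp_apply_apply, l2Distribution_apply, ← integral_neg]
    simp only [_root_.neg_apply, neg_smul]
  constructor
  · intro h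
    ext φ
    rw [lineDeriv_apply, h.integral_lineDeriv_smul, neg_neg, l2Distribution_apply]
  · intro h
    refine ⟨hf, hg, fun φ => ?_⟩
    rw [← l2Distribution_apply hg, ← h, lineDeriv_apply, neg_neg]

theorem HasL2LineDeriv.of_tendsto {v : E} {F G : ℕ → E → V} {f g : E → V}
    (h : ∀ n, HasL2LineDeriv v (F n) (G n)) (hf : MemLp f 2) (hg : MemLp g 2)
    (hFf : Tendsto (fun n => lpNorm (F n - f) 2 volume) atTop (𝓝 0))
    (hGg : Tendsto (fun n => lpNorm (G n - g) 2 volume) atTop (𝓝 0)) :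
    HasL2LineDeriv v f g := by
  rw [hasL2LineDeriv_iff hf hg]
  rw [← tendsto_toLp_iff_lpNorm_sub (fun n => (h n).memLp) hf] at hFf
  rw [← tendsto_toLp_iff_lpNorm_sub (fun n => (h n).memLp_deriv) hg] at hGg
  have hT := (Lp.toTemperedDistributionCLM V (volume : Measure E) 2).continuous
  have hD := (LineDeriv.lineDerivOpCLM ℂ 𝓢'(E, V) v).continuous
  refine tendsto_nhds_unique (((hD.comp hT).tendsto _).comp hFf)
    (((hT.tendsto _).comp hGg).congr fun n => ?_)
  exact ((hasL2LineDeriv_iff (h n).memLp (h n).memLp_deriv).1 (h n)).symm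

theorem HasL2LineDeriv.clm_comp [NormedAddCommGroup W] [InnerProductSpace ℂ W] [CompleteSpace W]
    {v : E} {f g : E → V} (L : V →L[ℂ] W) (h : HasL2LineDeriv v f g) :
    HasL2LineDeriv v (fun x => L (f x)) (fun x => L (g x)) := by
  refine ⟨L.comp_memLp' h.memLp, L.comp_memLp' h.memLp_deriv, fun φ => ?_⟩
  simp only [← map_smul]
  rw [L.integral_comp_comm (integrable_schwartz_smul _ h.memLp),
    L.integral_comp_comm (integrable_schwartz_smul _ h.memLp_deriv),
    h.integral_lineDeriv_smul, map_neg]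

end L2LineDeriv

section FourierMultipliers

open Filter Topology
open scoped SchwartzMap LineDeriv Laplacian FourierTransform Real

variable {E V : Type*} [NormedAddCommGroup E]

/-- The symbol of the resolvent `(1 - (2π)⁻² Δ)⁻¹`. -/
noncomputable def resolventSymbol (ξ : E) : ℂ := (((1 + ‖ξ‖ ^ 2) ^ (-1 : ℝ) : ℝ) : ℂ)

theorem norm_resolventSymbol (ξ : E) : ‖resolventSymbol ξ‖ = (1 + ‖ξ‖ ^ 2)⁻¹ := by
  rw [resolventSymbol, Complex.norm_real, Real.rpow_neg_one, Real.norm_of_nonneg (by positivity)]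

theorem norm_resolventSymbol_le (ξ : E) : ‖resolventSymbol ξ‖ ≤ 1 := by
  rw [norm_resolventSymbol]
  exact inv_le_one_of_one_le₀ (le_add_of_nonneg_right (sq_nonneg _))

variable [InnerProductSpace ℝ E]

theorem hasTemperateGrowth_resolventSymbol :
    (resolventSymbol : E → ℂ).HasTemperateGrowth := by
  unfold resolventSymbol
  fun_prop

/-- The symbol of the derivative along `v` composed with the multiplier of symbol `m`; the factor
`2πi` comes from the normalisation `𝓕 f ξ = ∫ e^(-2πi⟨x, ξ⟩) f x` of the Fourier transform. -/
noncomputable def lineDerivSymbol (v : E) (m : E → ℂ) (ξ : E) : ℂ :=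
  2 * π * Complex.I * (m ξ * (inner ℝ ξ v : ℝ))

theorem hasTemperateGrowth_lineDerivSymbol {m : E → ℂ} (hm : m.HasTemperateGrowth) (v : E) :
    (lineDerivSymbol v m).HasTemperateGrowth := by
  unfold lineDerivSymbol
  fun_prop

theorem norm_lineDerivSymbol_le {v : E} (hv : ‖v‖ ≤ 1) (m : E → ℂ) (ξ : E) :
    ‖lineDerivSymbol v m ξ‖ ≤ 2 * π * (‖ξ‖ * ‖m ξ‖) := by
  have hinner : |inner ℝ ξ v| ≤ ‖ξ‖ :=
    (abs_real_inner_le_norm ξ v).trans (mul_le_of_le_one_right (norm_nonneg _) hv)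
  simp only [lineDerivSymbol, norm_mul, Complex.norm_real, Complex.norm_I, Real.norm_eq_abs,
    Complex.norm_ofNat, abs_of_pos Real.pi_pos, mul_one]
  rw [mul_comm ‖m ξ‖]
  gcongr

theorem norm_lineDerivSymbol_resolventSymbol_le {v : E} (hv : ‖v‖ ≤ 1) (ξ : E) :
    ‖lineDerivSymbol v resolventSymbol ξ‖ ≤ 2 * π := by
  refine (norm_lineDerivSymbol_le hv _ ξ).trans (mul_le_of_le_one_right (by positivity) ?_)
  rw [norm_resolventSymbol, mul_inv_le_iff₀ (by positivity), one_mul]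
  nlinarith [sq_nonneg (‖ξ‖ - 1)]

theorem norm_lineDerivSymbol_lineDerivSymbol_resolventSymbol_le {v w : E} (hv : ‖v‖ ≤ 1)
    (hw : ‖w‖ ≤ 1) (ξ : E) :
    ‖lineDerivSymbol w (lineDerivSymbol v resolventSymbol) ξ‖ ≤ (2 * π) ^ 2 := by
  have sq_le_one : ‖ξ‖ ^ 2 * ‖resolventSymbol ξ‖ ≤ 1 := by
    rw [norm_resolventSymbol, mul_inv_le_iff₀ (by positivity), one_mul]
    exact le_add_of_nonneg_left zero_le_one
  calc ‖lineDerivSymbol w (lineDerivSymbol v resolventSymbol) ξ‖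
      ≤ 2 * π * (‖ξ‖ * (2 * π * (‖ξ‖ * ‖resolventSymbol ξ‖))) := by
        refine (norm_lineDerivSymbol_le hw _ ξ).trans ?_
        gcongr
        exact norm_lineDerivSymbol_le hv _ ξ
    _ = (2 * π) ^ 2 * (‖ξ‖ ^ 2 * ‖resolventSymbol ξ‖) := by ring
    _ ≤ (2 * π) ^ 2 := mul_le_of_le_one_right (by positivity) sq_le_one

variable [FiniteDimensional ℝ E] [MeasurableSpace E] [BorelSpace E]
  [NormedAddCommGroup V] [InnerProductSpace ℂ V]

theorem lineDeriv_fourierMultiplierCLM {m : E → ℂ} (hm : m.HasTemperateGrowth) (v : E)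
    (T : 𝓢'(E, V)) :
    ∂_{v} (TemperedDistribution.fourierMultiplierCLM V m T) =
      TemperedDistribution.fourierMultiplierCLM V (lineDerivSymbol v m) T := by
  have hv : (fun ξ : E => ((inner ℝ ξ v : ℝ) : ℂ)).HasTemperateGrowth := by fun_prop
  rw [TemperedDistribution.lineDeriv_eq_fourierMultiplierCLM,
    TemperedDistribution.fourierMultiplierCLM_fourierMultiplierCLM_apply hm hv,
    ← _root_.smul_apply, ← TemperedDistribution.fourierMultiplierCLM_smul (hm.mul hv)]
  rfl

theorem fourierMultiplierCLM_resolventSymbol (T : 𝓢'(E, V)) :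
    TemperedDistribution.fourierMultiplierCLM V resolventSymbol
      (T - (((2 * π) ^ 2)⁻¹ : ℂ) • Δ T) = T := by
  have sq_growth : (fun ξ : E => ((‖ξ‖ ^ 2 : ℝ) : ℂ)).HasTemperateGrowth := by fun_prop
  have scale : (((2 * π) ^ 2)⁻¹ : ℂ) * ((-(2 * π) ^ 2 : ℝ) : ℂ) = -1 := by
    push_cast
    field_simp
  have symbols : resolventSymbol + (fun ξ : E => ((‖ξ‖ ^ 2 : ℝ) : ℂ)) * resolventSymbol =
      fun _ => (1 : ℂ) := by
    ext ξ
    have : (1 + ‖ξ‖ ^ 2) ≠ 0 := by positivity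
    simp only [Pi.add_apply, Pi.mul_apply, resolventSymbol, Real.rpow_neg_one]
    norm_cast
    field_simp
  have add_multipliers : TemperedDistribution.fourierMultiplierCLM V resolventSymbol T +
      TemperedDistribution.fourierMultiplierCLM V
        ((fun ξ : E => ((‖ξ‖ ^ 2 : ℝ) : ℂ)) * resolventSymbol) T =
      TemperedDistribution.fourierMultiplierCLM V (fun _ => (1 : ℂ)) T := by
    simp only [TemperedDistribution.fourierMultiplierCLM_apply]
    rw [← FourierTransform.fourierInv_add, ← _root_.add_apply,
      ← TemperedDistribution.smulLeftCLM_add hasTemperateGrowth_resolventSymbol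
        (sq_growth.mul hasTemperateGrowth_resolventSymbol), symbols]
  rw [TemperedDistribution.laplacian_eq_fourierMultiplierCLM, map_sub, map_smul,
    ContinuousLinearMap.map_smul_of_tower,
    TemperedDistribution.fourierMultiplierCLM_fourierMultiplierCLM_apply sq_growth
      hasTemperateGrowth_resolventSymbol, ← Complex.coe_smul, smul_smul, scale, neg_one_smul,
    sub_neg_eq_add, add_multipliers, TemperedDistribution.fourierMultiplierCLM_const, one_smul]
  rfl

variable [CompleteSpace V]

theorem exists_fourierMultiplierCLM_toTemperedDistribution {m : E → ℂ}
    (hm : m.HasTemperateGrowth) {C : ℝ} (hC : ∀ x, ‖m x‖ ≤ C)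
    (u : Lp V 2 (volume : Measure E)) :
    ∃ v : Lp V 2 (volume : Measure E),
      TemperedDistribution.fourierMultiplierCLM V m (Lp.toTemperedDistribution u) =
        Lp.toTemperedDistribution v ∧ ‖v‖ ≤ C * ‖u‖ := by
  have hC0 : 0 ≤ C := (norm_nonneg _).trans (hC 0)
  have hmL : MemLp m ⊤ (volume : Measure E) :=
    memLp_top_of_bound hm.1.continuous.aestronglyMeasurable C (ae_of_all _ hC)
  have norm_symbol : ‖hmL.toLp m‖ ≤ C := by
    rw [Lp.norm_toLp]
    refine ENNReal.toReal_le_of_le_ofReal hC0 ?_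
    rw [eLpNorm_exponent_top]
    exact eLpNormEssSup_le_of_ae_bound (ae_of_all _ hC)
  let w : Lp V 2 (volume : Measure E) := hmL.toLp m • (𝓕 u : Lp V 2 (volume : Measure E))
  refine ⟨𝓕⁻ w, ?_, ?_⟩
  · rw [TemperedDistribution.fourierMultiplierCLM_apply, Lp.fourier_toTemperedDistribution_eq,
      ← Lp.toTemperedDistribution_smul_eq (r := 2) hm hmL, Lp.fourierInv_toTemperedDistribution_eq]
  · rw [← Lp.norm_fourier_eq, FourierTransform.fourier_fourierInv_eq]
    refine (Lp.norm_smul_le _ _).trans ?_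
    rw [Lp.norm_fourier_eq]
    exact mul_le_mul_of_nonneg_right norm_symbol (norm_nonneg _)

theorem lpNorm_le_of_fourierMultiplierCLM_eq {m : E → ℂ} (hm : m.HasTemperateGrowth) {C : ℝ}
    (hC : ∀ x, ‖m x‖ ≤ C) {f g : E → V} (hf : MemLp f 2) (hg : MemLp g 2)
    (h : TemperedDistribution.fourierMultiplierCLM V m (l2Distribution hf) = l2Distribution hg) :
    lpNorm g 2 volume ≤ C * lpNorm f 2 volume := by
  obtain ⟨v, hv, norm_v⟩ := exists_fourierMultiplierCLM_toTemperedDistribution hm hC (hf.toLp f)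
  have hvg : v = hg.toLp g :=
    LinearMap.ker_eq_bot.1 (Lp.ker_toTemperedDistributionCLM_eq_bot (F := V)
      (μ := (volume : Measure E)) (p := 2)) (hv.symm.trans h)
  rwa [hvg, Lp.norm_toLp, Lp.norm_toLp, toReal_eLpNorm hf.1, toReal_eLpNorm hg.1] at norm_v

theorem tendsto_lpNorm_sub_of_fourierMultiplierCLM_eq {m : E → ℂ} (hm : m.HasTemperateGrowth)
    {C : ℝ} (hC : ∀ x, ‖m x‖ ≤ C) {F G : ℕ → E → V} {f g : E → V} (hF : ∀ n, MemLp (F n) 2)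
    (hG : ∀ n, MemLp (G n) 2) (hf : MemLp f 2) (hg : MemLp g 2)
    (hFf : Tendsto (fun n => lpNorm (F n - f) 2 volume) atTop (𝓝 0))
    (h : TemperedDistribution.fourierMultiplierCLM V m (l2Distribution hf) = l2Distribution hg)
    (hFG : ∀ n, TemperedDistribution.fourierMultiplierCLM V m (l2Distribution (hF n)) =
      l2Distribution (hG n)) :
    Tendsto (fun n => lpNorm (G n - g) 2 volume) atTop (𝓝 0) := by
  refine squeeze_zero (fun n => lpNorm_nonneg)
    (fun n => lpNorm_le_of_fourierMultiplierCLM_eq hm hC ((hF n).sub hf) ((hG n).sub hg) ?_)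
    (by simpa only [mul_zero] using hFf.const_mul C)
  rw [l2Distribution_sub (hF n) hf, l2Distribution_sub (hG n) hg, map_sub, h, hFG]

theorem fourierMultiplierCLM_l2Distribution_schwartz {m : E → ℂ} (hm : m.HasTemperateGrowth)
    (f : 𝓢(E, V)) :
    TemperedDistribution.fourierMultiplierCLM V m (l2Distribution (f.memLp 2)) =
      l2Distribution ((SchwartzMap.fourierMultiplierCLM V m f).memLp 2) := by
  have toDistribution (u : 𝓢(E, V)) : l2Distribution (u.memLp 2) =
      SchwartzMap.toTemperedDistributionCLM E V volume u := Lp.toTemperedDistribution_toLp_eq u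
  rw [toDistribution, toDistribution,
    TemperedDistribution.fourierMultiplierCLM_toTemperedDistributionCLM_eq hm]

end FourierMultipliers

section LpTools

open Filter Topology

variable {α G : Type*} [MeasurableSpace α] {μ : Measure α} [NormedAddCommGroup G]

theorem lpNorm_ofNat_pow (n : ℕ) [n.AtLeastTwo] {f : α → G} (hf : AEStronglyMeasurable f μ) :
    lpNorm f ofNat(n) μ ^ n = ∫ x, ‖f x‖ ^ n ∂μ := by
  have hn : (n : ℝ) ≠ 0 := NeZero.ne _
  have hn' : (ofNat(n) : ℝ≥0∞).toReal = n := ENNReal.toReal_ofNat n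
  rw [lpNorm_eq_integral_norm_rpow_toReal (by simp) (by simp) hf, hn', ← Real.rpow_natCast,
    ← Real.rpow_mul (integral_nonneg fun x => by positivity), inv_mul_cancel₀ hn, Real.rpow_one]
  simp only [Real.rpow_natCast]

theorem lpNorm_top_le_of_forall_norm_le {f : α → G} (hf : AEStronglyMeasurable f μ) {C : ℝ}
    (hC : 0 ≤ C) (h : ∀ x, ‖f x‖ ≤ C) : lpNorm f ⊤ μ ≤ C := by
  rw [← toReal_eLpNorm hf, eLpNorm_exponent_top]
  exact ENNReal.toReal_le_of_le_ofReal hC (eLpNormEssSup_le_of_ae_bound (ae_of_all _ h))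

/-- `f` belongs to `L^p` with norm at most `R`. -/
structure HasLpBound (f : α → G) (p : ℝ≥0∞) (R : ℝ) (μ : Measure α := by volume_tac) : Prop where
  memLp : MemLp f p μ
  lpNorm_le : lpNorm f p μ ≤ R

namespace HasLpBound

variable {H K : Type*} [NormedAddCommGroup H] [NormedAddCommGroup K]
  {p q r : ℝ≥0∞} {f : α → G} {g : α → H} {k : α → K} {A B : ℝ}

theorem nonneg (hf : HasLpBound f p A μ) : 0 ≤ A := lpNorm_nonneg.trans hf.lpNorm_le

theorem mono (hf : HasLpBound f p A μ) (hAB : A ≤ B) : HasLpBound f p B μ :=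
  ⟨hf.memLp, hf.lpNorm_le.trans hAB⟩

theorem norm (hf : HasLpBound f p A μ) : HasLpBound (fun x => ‖f x‖) p A μ :=
  ⟨hf.memLp.norm, by rw [lpNorm_norm hf.memLp.1]; exact hf.lpNorm_le⟩

theorem add {f' : α → G} (hp : 1 ≤ p) (hf : HasLpBound f p A μ) (hf' : HasLpBound f' p B μ) :
    HasLpBound (f + f') p (A + B) μ :=
  ⟨hf.memLp.add hf'.memLp,
    (lpNorm_add_le hf.memLp hp).trans (add_le_add hf.lpNorm_le hf'.lpNorm_le)⟩

theorem of_norm_le_const_mul {c : ℝ} (hf : HasLpBound f p A μ) (hk : AEStronglyMeasurable k μ)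
    (hc : 0 ≤ c) (h : ∀ᵐ x ∂μ, ‖k x‖ ≤ c * ‖f x‖) : HasLpBound k p (c * A) μ := by
  have bound := eLpNorm_le_mul_eLpNorm_of_ae_le_mul h p
  have hcf : ENNReal.ofReal c * eLpNorm f p μ < ⊤ :=
    ENNReal.mul_lt_top ENNReal.ofReal_lt_top hf.memLp.2
  refine ⟨⟨hk, bound.trans_lt hcf⟩, ?_⟩
  have := ENNReal.toReal_mono hcf.ne bound
  rw [ENNReal.toReal_mul, ENNReal.toReal_ofReal hc, toReal_eLpNorm hk,
    toReal_eLpNorm hf.memLp.1] at this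
  exact this.trans (mul_le_mul_of_nonneg_left hf.lpNorm_le hc)

theorem const_mul {φ : α → ℝ} {c : ℝ} (hφ : HasLpBound φ p A μ) (hc : 0 ≤ c) :
    HasLpBound (fun x => c * φ x) p (c * A) μ :=
  hφ.of_norm_le_const_mul (hφ.memLp.1.const_mul c) hc
    (ae_of_all _ fun x => by rw [norm_mul, Real.norm_of_nonneg hc])

theorem of_norm_le (hf : HasLpBound f p A μ) (hk : AEStronglyMeasurable k μ)
    (h : ∀ᵐ x ∂μ, ‖k x‖ ≤ ‖f x‖) : HasLpBound k p A μ := by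
  simpa only [one_mul] using
    hf.of_norm_le_const_mul hk zero_le_one (by simpa only [one_mul] using h)

theorem norm_mul_norm [ENNReal.HolderTriple p q r] (hf : HasLpBound f p A μ)
    (hg : HasLpBound g q B μ) : HasLpBound (fun x => ‖f x‖ * ‖g x‖) r (A * B) μ := by
  have hfg : MemLp (fun x => ‖f x‖ * ‖g x‖) r μ := hg.norm.memLp.mul hf.norm.memLp
  refine ⟨hfg, ?_⟩
  have holder : eLpNorm (fun x => ‖f x‖ * ‖g x‖) r μ ≤ eLpNorm f p μ * eLpNorm g q μ := by
    simpa only [eLpNorm_norm] using!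
      eLpNorm_smul_le_mul_eLpNorm (r := r) hg.norm.memLp.1 hf.norm.memLp.1
  have := ENNReal.toReal_mono (ENNReal.mul_ne_top hf.memLp.2.ne hg.memLp.2.ne) holder
  rw [ENNReal.toReal_mul, toReal_eLpNorm hfg.1, toReal_eLpNorm hf.memLp.1,
    toReal_eLpNorm hg.memLp.1] at this
  exact this.trans (mul_le_mul hf.lpNorm_le hg.lpNorm_le lpNorm_nonneg hf.nonneg)

theorem of_tendsto (hq : q ≠ 0) {F : ℕ → α → G}
    (hF : ∀ n, MemLp (F n) q μ) (hf : MemLp f q μ)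
    (hFf : Tendsto (fun n => lpNorm (F n - f) q μ) atTop (𝓝 0)) {c : ℕ → ℝ} {a : ℝ}
    (hc : Tendsto c atTop (𝓝 a)) (h : ∀ n, HasLpBound (F n) p (c n) μ) :
    HasLpBound f p a μ := by
  have tendsto_eLpNorm : Tendsto (fun n => eLpNorm (F n - f) q μ) atTop (𝓝 0) := by
    have h := (ENNReal.continuous_ofReal.tendsto 0).comp hFf
    rw [ENNReal.ofReal_zero] at h
    exact h.congr fun n => ofReal_lpNorm ((hF n).sub hf)
  obtain ⟨ns, hns, hae⟩ := (tendstoInMeasure_of_tendsto_eLpNorm hq (fun n => (hF n).1) hf.1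
    tendsto_eLpNorm).exists_seq_tendsto_ae
  have bound : eLpNorm f p μ ≤ ENNReal.ofReal a := by
    refine (Lp.eLpNorm_lim_le_liminf_eLpNorm (fun n => (hF (ns n)).1) f hae).trans ?_
    rw [← ((ENNReal.continuous_ofReal.tendsto a).comp (hc.comp hns.tendsto_atTop)).liminf_eq]
    refine liminf_le_liminf (Eventually.of_forall fun n => ?_)
    rw [← ofReal_lpNorm (h _).memLp]
    exact ENNReal.ofReal_le_ofReal (h _).lpNorm_le
  have ha : 0 ≤ a := ge_of_tendsto' hc fun n => (h n).nonneg
  refine ⟨⟨hf.1, bound.trans_lt ENNReal.ofReal_lt_top⟩, ?_⟩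
  rw [← toReal_eLpNorm hf.1]
  exact ENNReal.toReal_le_of_le_ofReal ha bound

end HasLpBound

theorem tendsto_lpNorm_of_tendsto_lpNorm_sub {q : ℝ≥0∞} (hq : 1 ≤ q) {F : ℕ → α → G} {f : α → G}
    (hF : ∀ n, MemLp (F n) q μ) (hf : MemLp f q μ)
    (hFf : Tendsto (fun n => lpNorm (F n - f) q μ) atTop (𝓝 0)) :
    Tendsto (fun n => lpNorm (F n) q μ) atTop (𝓝 (lpNorm f q μ)) := by
  rw [tendsto_iff_dist_tendsto_zero]
  refine squeeze_zero (fun n => dist_nonneg) (fun n => ?_) hFf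
  rw [Real.dist_eq, abs_sub_le_iff]
  have := lpNorm_le_lpNorm_add_lpNorm_sub' (f := F n) hf hq
  have := lpNorm_le_lpNorm_add_lpNorm_sub (f := f) (hF n) hq
  constructor <;> linarith

instance holderTriple_four_four_two : ENNReal.HolderTriple 4 4 2 where
  inv_add_inv_eq_inv := by
    rw [← two_mul, show (4 : ℝ≥0∞) = 2 * 2 by norm_num, ENNReal.mul_inv (by simp) (by simp),
      ← mul_assoc, ENNReal.mul_inv_cancel (by simp) (by simp), one_mul]

theorem integral_norm_sq_mul_norm_le {H : Type*} [NormedAddCommGroup H] {u : α → G} {w : α → H}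
    (hu : MemLp u 4 μ) (hw : MemLp w 2 μ) :
    Integrable (fun x => ‖u x‖ ^ 2 * ‖w x‖) μ ∧
      ∫ x, ‖u x‖ ^ 2 * ‖w x‖ ∂μ ≤ lpNorm u 4 μ ^ 2 * lpNorm w 2 μ := by
  have hu' : HasLpBound u 4 (lpNorm u 4 μ) μ := ⟨hu, le_rfl⟩
  have huw := (hu'.norm_mul_norm (r := 2) hu').norm_mul_norm (r := 1) ⟨hw, le_rfl⟩
  simp only [← sq, norm_pow, norm_norm] at huw
  refine ⟨memLp_one_iff_integrable.1 huw.memLp, huw.lpNorm_le.trans' ?_⟩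
  rw [lpNorm_one_eq_integral_norm huw.memLp.1]
  simp only [norm_mul, norm_pow, norm_norm, le_refl]

end LpTools

section TwoJets

open Filter Topology
open scoped SchwartzMap LineDeriv Laplacian FourierTransform Real

variable {ι E V : Type*}

/-- A function `val : E → V` together with candidates for its first and second partial derivatives
`grad i = ∂ᵢ val` and `hess i j = ∂ⱼ ∂ᵢ val`. Carrying the derivatives as data avoids choosing
representatives of weak derivatives. -/
structure TwoJet (ι E V : Type*) where
  val : E → V
  grad : ι → E → V
  hess : ι → ι → E → V

namespace TwoJet

instance [Sub V] : Sub (TwoJet ι E V) :=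
  ⟨fun J J' => ⟨J.val - J'.val, J.grad - J'.grad, J.hess - J'.hess⟩⟩

theorem val_sub [Sub V] (J J' : TwoJet ι E V) : (J - J').val = J.val - J'.val := rfl

instance [Zero V] : Zero (TwoJet ι E V) :=
  ⟨⟨0, 0, 0⟩⟩

protected theorem sub_zero [AddGroup V] (J : TwoJet ι E V) : J - 0 = J := by
  cases J
  exact congr (congr (congrArg mk (_root_.sub_zero _)) (_root_.sub_zero _)) (_root_.sub_zero _)

variable [NormedAddCommGroup V] [Fintype ι]

/-- The Laplacian recorded by a two-jet, i.e. the trace of its Hessian. -/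
def lap (J : TwoJet ι E V) : E → V := ∑ i, J.hess i i

theorem lap_sub (J J' : TwoJet ι E V) : (J - J').lap = J.lap - J'.lap :=
  Finset.sum_sub_distrib _ _

variable [NormedAddCommGroup E] [InnerProductSpace ℝ E] [FiniteDimensional ℝ E]
  [MeasurableSpace E] [BorelSpace E]

/-- The norm `(‖f‖² + ‖Δf‖²)^(1/2)` of `H²`, where both norms on the right are `L²` norms. -/
noncomputable def h2Norm (J : TwoJet ι E V) : ℝ :=
  √(lpNorm J.val 2 volume ^ 2 + lpNorm J.lap 2 volume ^ 2)

theorem h2Norm_nonneg (J : TwoJet ι E V) : 0 ≤ J.h2Norm := Real.sqrt_nonneg _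

theorem lpNorm_val_le_h2Norm (J : TwoJet ι E V) : lpNorm J.val 2 volume ≤ J.h2Norm :=
  Real.le_sqrt_of_sq_le (le_add_of_nonneg_right (sq_nonneg _))

theorem lpNorm_lap_le_h2Norm (J : TwoJet ι E V) : lpNorm J.lap 2 volume ≤ J.h2Norm :=
  Real.le_sqrt_of_sq_le (le_add_of_nonneg_left (sq_nonneg _))

theorem h2Norm_le_add (J : TwoJet ι E V) :
    J.h2Norm ≤ lpNorm J.val 2 volume + lpNorm J.lap 2 volume :=
  Real.sqrt_le_iff.2 ⟨add_nonneg lpNorm_nonneg lpNorm_nonneg, by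
    nlinarith [lpNorm_nonneg (f := J.val) (p := 2) (μ := volume),
      lpNorm_nonneg (f := J.lap) (p := 2) (μ := volume)]⟩

/-- Componentwise `L²` convergence of two-jets. -/
structure TendstoL2 (K : ℕ → TwoJet ι E V) (J : TwoJet ι E V) : Prop where
  val : Tendsto (fun n => lpNorm ((K n).val - J.val) 2 volume) atTop (𝓝 0)
  grad : ∀ i, Tendsto (fun n => lpNorm ((K n).grad i - J.grad i) 2 volume) atTop (𝓝 0)
  hess : ∀ i j, Tendsto (fun n => lpNorm ((K n).hess i j - J.hess i j) 2 volume) atTop (𝓝 0)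

variable [InnerProductSpace ℂ V]

/-- A two-jet belongs to `H²` if all its components are in `L²` and it records the distributional
derivatives of `val` in the coordinates given by the orthonormal basis `b`. -/
structure IsH2 (b : OrthonormalBasis ι ℝ E) (J : TwoJet ι E V) : Prop where
  memLp : MemLp J.val 2
  hasL2LineDeriv_val : ∀ i, HasL2LineDeriv (b i) J.val (J.grad i)
  hasL2LineDeriv_grad : ∀ i j, HasL2LineDeriv (b j) (J.grad i) (J.hess i j)

/-- The two-jet of a Schwartz function. -/
noncomputable def ofSchwartz (b : OrthonormalBasis ι ℝ E) (f : 𝓢(E, V)) : TwoJet ι E V where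
  val := f
  grad i := (∂_{b i} f : 𝓢(E, V))
  hess i j := (∂_{b j} (∂_{b i} f : 𝓢(E, V)) : 𝓢(E, V))

theorem isH2_ofSchwartz (b : OrthonormalBasis ι ℝ E) (f : 𝓢(E, V)) : (ofSchwartz b f).IsH2 b :=
  ⟨f.memLp 2 volume, fun i => hasL2LineDeriv_schwartz (b i) f,
    fun i j => hasL2LineDeriv_schwartz (b j) (∂_{b i} f)⟩

namespace IsH2

variable {b : OrthonormalBasis ι ℝ E} {J J' : TwoJet ι E V}

theorem memLp_grad (h : J.IsH2 b) (i : ι) : MemLp (J.grad i) 2 :=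
  (h.hasL2LineDeriv_val i).memLp_deriv

theorem memLp_hess (h : J.IsH2 b) (i j : ι) : MemLp (J.hess i j) 2 :=
  (h.hasL2LineDeriv_grad i j).memLp_deriv

theorem memLp_lap (h : J.IsH2 b) : MemLp J.lap 2 :=
  memLp_finsetSum' _ fun i _ => h.memLp_hess i i

theorem sub (h : J.IsH2 b) (h' : J'.IsH2 b) : (J - J').IsH2 b :=
  ⟨h.memLp.sub h'.memLp, fun i => (h.hasL2LineDeriv_val i).sub (h'.hasL2LineDeriv_val i),
    fun i j => (h.hasL2LineDeriv_grad i j).sub (h'.hasL2LineDeriv_grad i j)⟩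

theorem tendsto_lpNorm_lap_sub {K : ℕ → TwoJet ι E V} (hK : ∀ n, (K n).IsH2 b) (hJ : J.IsH2 b)
    (h : TendstoL2 K J) :
    Tendsto (fun n => lpNorm ((K n).lap - J.lap) 2 volume) atTop (𝓝 0) := by
  refine squeeze_zero (fun n => lpNorm_nonneg) (fun n => ?_)
    (by simpa only [Finset.sum_const_zero] using
      tendsto_finsetSum Finset.univ fun i _ => h.hess i i)
  rw [← lap_sub]
  exact lpNorm_sum_le (fun i _ => ((hK n).sub hJ).memLp_hess i i) one_le_two

theorem tendsto_h2Norm {K : ℕ → TwoJet ι E V} (hK : ∀ n, (K n).IsH2 b) (hJ : J.IsH2 b)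
    (h : TendstoL2 K J) : Tendsto (fun n => (K n).h2Norm) atTop (𝓝 J.h2Norm) :=
  have tendsto_val := tendsto_lpNorm_of_tendsto_lpNorm_sub one_le_two
    (fun n => (hK n).memLp) hJ.memLp h.val
  have tendsto_lap := tendsto_lpNorm_of_tendsto_lpNorm_sub one_le_two
    (fun n => (hK n).memLp_lap) hJ.memLp_lap (tendsto_lpNorm_lap_sub hK hJ h)
  ((tendsto_val.pow 2).add (tendsto_lap.pow 2)).sqrt

theorem tendsto_h2Norm_sub {K : ℕ → TwoJet ι E V} (hK : ∀ n, (K n).IsH2 b) (hJ : J.IsH2 b)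
    (h : TendstoL2 K J) : Tendsto (fun n => (K n - J).h2Norm) atTop (𝓝 0) := by
  refine squeeze_zero (fun n => h2Norm_nonneg _) (fun n => h2Norm_le_add _) ?_
  simpa only [add_zero, val_sub, lap_sub] using h.val.add (tendsto_lpNorm_lap_sub hK hJ h)

variable [CompleteSpace V]

theorem of_tendstoL2 {K : ℕ → TwoJet ι E V} (hK : ∀ n, (K n).IsH2 b) (hval : MemLp J.val 2)
    (hgrad : ∀ i, MemLp (J.grad i) 2) (hhess : ∀ i j, MemLp (J.hess i j) 2)
    (h : TendstoL2 K J) : J.IsH2 b :=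
  ⟨hval,
    fun i => .of_tendsto (fun n => (hK n).hasL2LineDeriv_val i) hval (hgrad i) h.val (h.grad i),
    fun i j => .of_tendsto (fun n => (hK n).hasL2LineDeriv_grad i j) (hgrad i) (hhess i j)
      (h.grad i) (h.hess i j)⟩

theorem laplacian_l2Distribution (h : J.IsH2 b) :
    Δ (l2Distribution h.memLp) = l2Distribution h.memLp_lap := by
  have second_deriv (i : ι) :
      ∂_{b i} (∂_{b i} (l2Distribution h.memLp)) = l2Distribution (h.memLp_hess i i) := by
    rw [(hasL2LineDeriv_iff h.memLp (h.memLp_grad i)).1 (h.hasL2LineDeriv_val i),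
      (hasL2LineDeriv_iff (h.memLp_grad i) (h.memLp_hess i i)).1 (h.hasL2LineDeriv_grad i i)]
  rw [TemperedDistribution.laplacian_eq_sum b]
  ext φ
  simp only [second_deriv, sum_apply, l2Distribution_apply, lap,
    Finset.sum_apply, Finset.smul_sum]
  exact (integral_finsetSum _ fun i _ => integrable_schwartz_smul φ (h.memLp_hess i i)).symm

end IsH2

/-- `(1 - (2π)⁻² Δ) f`, from which `f` is recovered by the multiplier `resolventSymbol`. -/
noncomputable def resolventSource (J : TwoJet ι E V) : E → V :=
  J.val - (((2 * π) ^ 2)⁻¹ : ℂ) • J.lap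

namespace IsH2

variable {b : OrthonormalBasis ι ℝ E} {J : TwoJet ι E V}

theorem memLp_resolventSource (h : J.IsH2 b) : MemLp J.resolventSource 2 :=
  h.memLp.sub (h.memLp_lap.const_smul _)

theorem lpNorm_resolventSource_le (h : J.IsH2 b) :
    lpNorm J.resolventSource 2 volume ≤ 2 * J.h2Norm := by
  have scale : ‖(((2 * π) ^ 2)⁻¹ : ℂ)‖ ≤ 1 := by
    have : (1 : ℝ) ≤ (2 * π) ^ 2 := by nlinarith [Real.pi_gt_three]
    rw [norm_inv, norm_pow, norm_mul, Complex.norm_ofNat, Complex.norm_real,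
      Real.norm_of_nonneg Real.pi_pos.le]
    exact inv_le_one_of_one_le₀ this
  calc
    lpNorm J.resolventSource 2 volume
      ≤ lpNorm J.val 2 volume + ‖(((2 * π) ^ 2)⁻¹ : ℂ)‖ * lpNorm J.lap 2 volume := by
        rw [← coe_nnnorm, ← lpNorm_const_smul]
        exact lpNorm_sub_le h.memLp one_le_two
    _ ≤ J.h2Norm + 1 * J.h2Norm := by
        gcongr
        exacts [J.lpNorm_val_le_h2Norm, lpNorm_nonneg, J.lpNorm_lap_le_h2Norm]
    _ = 2 * J.h2Norm := by ring

variable [CompleteSpace V]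

theorem fourierMultiplierCLM_grad (h : J.IsH2 b) {T : 𝓢'(E, V)}
    (hT : TemperedDistribution.fourierMultiplierCLM V resolventSymbol T = l2Distribution h.memLp)
    (i : ι) :
    TemperedDistribution.fourierMultiplierCLM V (lineDerivSymbol (b i) resolventSymbol) T =
      l2Distribution (h.memLp_grad i) := by
  rw [← lineDeriv_fourierMultiplierCLM hasTemperateGrowth_resolventSymbol, hT,
    (hasL2LineDeriv_iff _ _).1 (h.hasL2LineDeriv_val i)]

theorem fourierMultiplierCLM_hess (h : J.IsH2 b) {T : 𝓢'(E, V)}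
    (hT : TemperedDistribution.fourierMultiplierCLM V resolventSymbol T = l2Distribution h.memLp)
    (i j : ι) :
    TemperedDistribution.fourierMultiplierCLM V
      (lineDerivSymbol (b j) (lineDerivSymbol (b i) resolventSymbol)) T =
      l2Distribution (h.memLp_hess i j) := by
  rw [← lineDeriv_fourierMultiplierCLM
      (hasTemperateGrowth_lineDerivSymbol hasTemperateGrowth_resolventSymbol _),
    h.fourierMultiplierCLM_grad hT, (hasL2LineDeriv_iff _ _).1 (h.hasL2LineDeriv_grad i j)]

theorem fourierMultiplierCLM_resolventSource (h : J.IsH2 b) :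
    TemperedDistribution.fourierMultiplierCLM V resolventSymbol
      (l2Distribution h.memLp_resolventSource) = l2Distribution h.memLp := by
  have smul_lap : l2Distribution (h.memLp_lap.const_smul (((2 * π) ^ 2)⁻¹ : ℂ)) =
      (((2 * π) ^ 2)⁻¹ : ℂ) • Δ (l2Distribution h.memLp) := by
    rw [h.laplacian_l2Distribution]
    ext φ
    simp only [l2Distribution_apply, _root_.smul_apply, Pi.smul_apply, smul_comm (φ _),
      integral_smul]
  rw [← fourierMultiplierCLM_resolventSymbol (l2Distribution h.memLp), ← smul_lap,
    ← l2Distribution_sub]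
  rfl

theorem lpNorm_grad_le (h : J.IsH2 b) (i : ι) :
    lpNorm (J.grad i) 2 volume ≤ 2 * (2 * π) * J.h2Norm := by
  refine (lpNorm_le_of_fourierMultiplierCLM_eq
    (hasTemperateGrowth_lineDerivSymbol hasTemperateGrowth_resolventSymbol _)
    (norm_lineDerivSymbol_resolventSymbol_le (b.norm_eq_one i).le) _ _
    (h.fourierMultiplierCLM_grad h.fourierMultiplierCLM_resolventSource i)).trans ?_
  rw [mul_comm 2 (2 * π), mul_assoc (2 * π)]
  exact mul_le_mul_of_nonneg_left h.lpNorm_resolventSource_le (by positivity)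

theorem lpNorm_hess_le (h : J.IsH2 b) (i j : ι) :
    lpNorm (J.hess i j) 2 volume ≤ 2 * (2 * π) ^ 2 * J.h2Norm := by
  refine (lpNorm_le_of_fourierMultiplierCLM_eq
    (hasTemperateGrowth_lineDerivSymbol
      (hasTemperateGrowth_lineDerivSymbol hasTemperateGrowth_resolventSymbol _) _)
    (norm_lineDerivSymbol_lineDerivSymbol_resolventSymbol_le (b.norm_eq_one i).le
      (b.norm_eq_one j).le) _ _
    (h.fourierMultiplierCLM_hess h.fourierMultiplierCLM_resolventSource i j)).trans ?_
  rw [mul_comm 2 ((2 * π) ^ 2), mul_assoc ((2 * π) ^ 2)]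
  exact mul_le_mul_of_nonneg_left h.lpNorm_resolventSource_le (by positivity)

theorem exists_schwartz_tendstoL2 (h : J.IsH2 b) :
    ∃ F : ℕ → 𝓢(E, V), TendstoL2 (fun n => ofSchwartz b (F n)) J := by
  have hρ := hasTemperateGrowth_resolventSymbol (E := E)
  have hG := h.memLp_resolventSource
  obtain ⟨H, hH⟩ := exists_schwartz_tendsto_lpNorm_sub (by simp) hG
  have hH2 n := (H n).memLp 2 volume
  let F n := SchwartzMap.fourierMultiplierCLM V resolventSymbol (H n)
  have hF n := isH2_ofSchwartz b (F n)
  have val_F n : TemperedDistribution.fourierMultiplierCLM V resolventSymbol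
      (l2Distribution (hH2 n)) = l2Distribution (hF n).memLp :=
    fourierMultiplierCLM_l2Distribution_schwartz hρ (H n)
  have val_J := h.fourierMultiplierCLM_resolventSource
  have hb i : ‖b i‖ ≤ 1 := (b.norm_eq_one i).le
  have hρ' i := hasTemperateGrowth_lineDerivSymbol hρ (b i)
  exact ⟨F,
    tendsto_lpNorm_sub_of_fourierMultiplierCLM_eq hρ norm_resolventSymbol_le
      hH2 _ hG _ hH val_J val_F,
    fun i => tendsto_lpNorm_sub_of_fourierMultiplierCLM_eq (hρ' i)
      (norm_lineDerivSymbol_resolventSymbol_le (hb i))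
      hH2 _ hG _ hH (h.fourierMultiplierCLM_grad val_J i)
      fun n => (hF n).fourierMultiplierCLM_grad (val_F n) i,
    fun i j => tendsto_lpNorm_sub_of_fourierMultiplierCLM_eq
      (hasTemperateGrowth_lineDerivSymbol (hρ' i) (b j))
      (norm_lineDerivSymbol_lineDerivSymbol_resolventSymbol_le (hb i) (hb j))
      hH2 _ hG _ hH (h.fourierMultiplierCLM_hess val_J i j)
      fun n => (hF n).fourierMultiplierCLM_hess (val_F n) i j⟩

end IsH2

end TwoJet

end TwoJets

section SobolevEmbedding

open Filter Topology
open scoped SchwartzMap LineDeriv FourierTransform Real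

section GagliardoNirenberg

variable {E V : Type*} [NormedAddCommGroup E] [NormedSpace ℝ E]
  [NormedAddCommGroup V] [InnerProductSpace ℝ V]

theorem hasLineDerivAt_norm_sq_smul {u : E → V} {u' : V} {x v : E}
    (h : HasLineDerivAt ℝ u u' x v) :
    HasLineDerivAt ℝ (fun y => ‖u y‖ ^ 2 • u y) (‖u x‖ ^ 2 • u' + (2 * inner ℝ (u x) u') • u x)
      x v := by
  have h : HasDerivAt (fun t : ℝ => u (x + t • v)) u' 0 := h
  simpa only [zero_smul, add_zero] using! h.norm_sq.smul h

theorem norm_norm_sq_smul_add_le (u w : V) :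
    ‖‖u‖ ^ 2 • w + (2 * inner ℝ u w) • u‖ ≤ 3 * (‖u‖ ^ 2 * ‖w‖) := calc
  ‖‖u‖ ^ 2 • w + (2 * inner ℝ u w) • u‖ ≤ ‖u‖ ^ 2 * ‖w‖ + 2 * (‖u‖ * ‖w‖) * ‖u‖ := by
    refine (norm_add_le _ _).trans ?_
    simp only [norm_smul, norm_mul, norm_pow, norm_norm, Real.norm_ofNat]
    gcongr
    exact norm_inner_le_norm u w
  _ = 3 * (‖u‖ ^ 2 * ‖w‖) := by ring

variable [FiniteDimensional ℝ E] [MeasurableSpace E] [BorelSpace E]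
variable {μ : Measure E} [μ.IsAddHaarMeasure]

theorem integrable_inner_schwartz (w : 𝓢(E, V)) {k : E → V} {C : ℝ} (hk : Continuous k)
    (hC : ∀ x, ‖k x‖ ≤ C) : Integrable (fun x => innerSL ℝ (w x) (k x)) μ :=
  (w.integrable.norm.mul_const C).mono' (by fun_prop) (ae_of_all _ fun x =>
    (norm_inner_le_norm _ _).trans (mul_le_mul_of_nonneg_left (hC x) (norm_nonneg _)))

theorem integral_norm_lineDeriv_pow_four_le (f : 𝓢(E, V)) (v : E) :
    ∫ x, ‖(∂_{v} f) x‖ ^ 4 ∂μ ≤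
      3 * lpNorm f ⊤ μ * ∫ x, ‖(∂_{v} f) x‖ ^ 2 * ‖(∂_{v} (∂_{v} f)) x‖ ∂μ := by
  set u : 𝓢(E, V) := ∂_{v} f
  set u' : 𝓢(E, V) := ∂_{v} u
  obtain ⟨M, hM⟩ : ∃ M, ∀ x, ‖u x‖ ≤ M := ⟨_, SchwartzMap.norm_le_seminorm ℝ u⟩
  obtain ⟨M', hM'⟩ : ∃ M', ∀ x, ‖u' x‖ ≤ M' := ⟨_, SchwartzMap.norm_le_seminorm ℝ u'⟩
  let g x := ‖u x‖ ^ 2 • u x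
  let g' x := ‖u x‖ ^ 2 • u' x + (2 * inner ℝ (u x) (u' x)) • u x
  have hg : Continuous g := by fun_prop
  have hg' : Continuous g' := by fun_prop
  have norm_g x : ‖g x‖ ≤ M ^ 2 * M := by
    rw [norm_smul, norm_pow, norm_norm]
    gcongr <;> exact hM x
  have norm_g' x : ‖g' x‖ ≤ 3 * (M ^ 2 * M') :=
    (norm_norm_sq_smul_add_le _ _).trans (by gcongr; exacts [hM x, hM' x])
  have norm_f_mul_g' : ∀ᵐ x ∂μ,
      ‖f x‖ * ‖g' x‖ ≤ lpNorm f ⊤ μ * (3 * (‖u x‖ ^ 2 * ‖u' x‖)) := by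
    filter_upwards [ae_le_lpNorm_exponent_top (f.memLp ⊤ μ)] with x hx
    exact mul_le_mul hx (norm_norm_sq_smul_add_le _ _) (norm_nonneg _) lpNorm_nonneg
  have parts := integral_bilinear_hasLineDerivAt_right_eq_neg_left_of_integrable (μ := μ)
    (integrable_inner_schwartz u hg norm_g) (integrable_inner_schwartz f hg' norm_g')
    (integrable_inner_schwartz f hg norm_g) (fun x _ => hasLineDerivAt_schwartz f x v)
    fun x _ => hasLineDerivAt_norm_sq_smul (hasLineDerivAt_schwartz u x v)
  calc ∫ x, ‖u x‖ ^ 4 ∂μ = ∫ x, innerSL ℝ (u x) (g x) ∂μ := by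
        simp only [g, innerSL_apply_apply, real_inner_smul_right, real_inner_self_eq_norm_sq,
          ← pow_add]
    _ = ∫ x, -innerSL ℝ (f x) (g' x) ∂μ := by rw [integral_neg, parts, neg_neg]
    _ ≤ ∫ x, lpNorm f ⊤ μ * (3 * (‖u x‖ ^ 2 * ‖u' x‖)) ∂μ :=
        integral_mono_ae (integrable_inner_schwartz f hg' norm_g').neg
          (((integral_norm_sq_mul_norm_le (u.memLp 4 μ) (u'.memLp 2 μ)).1.const_mul 3).const_mul _)
          (norm_f_mul_g'.mono fun x hx =>
            (neg_le_abs _).trans ((abs_real_inner_le_norm _ _).trans hx))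
    _ = 3 * lpNorm f ⊤ μ * ∫ x, ‖u x‖ ^ 2 * ‖u' x‖ ∂μ := by
        rw [integral_const_mul, integral_const_mul, ← mul_assoc, mul_comm 3]

theorem lpNorm_lineDeriv_four_sq_le (f : 𝓢(E, V)) (v : E) :
    lpNorm (∂_{v} f : 𝓢(E, V)) 4 μ ^ 2 ≤
      3 * lpNorm f ⊤ μ * lpNorm (∂_{v} (∂_{v} f) : 𝓢(E, V)) 2 μ := by
  set u : 𝓢(E, V) := ∂_{v} f
  have hu := u.memLp 4 μ
  have hu' := (∂_{v} u : 𝓢(E, V)).memLp 2 μ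
  rcases (sq_nonneg (lpNorm u 4 μ)).eq_or_lt with h0 | hpos
  · rw [← h0]
    exact mul_nonneg (mul_nonneg (by norm_num) lpNorm_nonneg) lpNorm_nonneg
  refine le_of_mul_le_mul_right ?_ hpos
  calc lpNorm u 4 μ ^ 2 * lpNorm u 4 μ ^ 2 = ∫ x, ‖u x‖ ^ 4 ∂μ := by
        rw [← pow_add, ← lpNorm_ofNat_pow 4 hu.1]
    _ ≤ 3 * lpNorm f ⊤ μ * ∫ x, ‖u x‖ ^ 2 * ‖(∂_{v} u) x‖ ∂μ :=
        integral_norm_lineDeriv_pow_four_le f v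
    _ ≤ 3 * lpNorm f ⊤ μ * (lpNorm u 4 μ ^ 2 * lpNorm (∂_{v} u : 𝓢(E, V)) 2 μ) :=
        mul_le_mul_of_nonneg_left (integral_norm_sq_mul_norm_le hu hu').2
          (mul_nonneg (by norm_num) lpNorm_nonneg)
    _ = 3 * lpNorm f ⊤ μ * lpNorm (∂_{v} u : 𝓢(E, V)) 2 μ * lpNorm u 4 μ ^ 2 := by ring

end GagliardoNirenberg

variable {E V : Type*} [NormedAddCommGroup E] [InnerProductSpace ℝ E] [FiniteDimensional ℝ E]
  [MeasurableSpace E] [BorelSpace E]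

theorem memLp_resolventSymbol (hE : Module.finrank ℝ E ≤ 3) :
    MemLp (resolventSymbol : E → ℂ) 2 := by
  have hc : AEStronglyMeasurable (resolventSymbol : E → ℂ) :=
    hasTemperateGrowth_resolventSymbol.1.continuous.aestronglyMeasurable
  rw [memLp_two_iff_integrable_sq_norm hc]
  have hr : (Module.finrank ℝ E : ℝ) < 4 := by exact_mod_cast hE.trans_lt (by norm_num)
  refine (integrable_rpow_neg_one_add_norm_sq (μ := volume) hr).congr (ae_of_all _ fun ξ => ?_)
  beta_reduce
  rw [norm_resolventSymbol, show (-4 / 2 : ℝ) = -(2 : ℕ) by norm_num,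
    Real.rpow_neg (by positivity), Real.rpow_natCast, inv_pow]

variable [NormedAddCommGroup V]

namespace TwoJet

variable {ι : Type*} {J : TwoJet ι E V} {R : ℝ}

/-- A common bound `R` for a two-jet in the spaces into which `H²` and its derivatives embed in
dimension at most three: besides `L²`, these are `L^∞` for the value and `L⁴` for the gradient. -/
structure HasSobolevBound (J : TwoJet ι E V) (R : ℝ) : Prop where
  val_two : HasLpBound J.val 2 R
  val_top : HasLpBound J.val ⊤ R
  grad_two : ∀ i, HasLpBound (J.grad i) 2 R
  grad_four : ∀ i, HasLpBound (J.grad i) 4 R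
  hess_two : ∀ i j, HasLpBound (J.hess i j) 2 R

theorem HasSobolevBound.norm_val_le (h : J.HasSobolevBound R) : ∀ᵐ x, ‖J.val x‖ ≤ R := by
  filter_upwards [ae_le_lpNorm_exponent_top h.val_top.memLp] with x hx
  exact hx.trans h.val_top.lpNorm_le

theorem HasSobolevBound.mono {R' : ℝ} (h : J.HasSobolevBound R) (hR : R ≤ R') :
    J.HasSobolevBound R' :=
  ⟨h.val_two.mono hR, h.val_top.mono hR, fun i => (h.grad_two i).mono hR,
    fun i => (h.grad_four i).mono hR, fun i j => (h.hess_two i j).mono hR⟩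

theorem hasSobolevBound_zero (hR : 0 ≤ R) : (0 : TwoJet ι E V).HasSobolevBound R :=
  have zero_bound (p : ℝ≥0∞) : HasLpBound (0 : E → V) p R := ⟨.zero, by rwa [lpNorm_zero]⟩
  ⟨zero_bound 2, zero_bound ⊤, fun _ => zero_bound 2, fun _ => zero_bound 4,
    fun _ _ => zero_bound 2⟩

end TwoJet

variable [InnerProductSpace ℂ V] [CompleteSpace V]

theorem norm_fourierMultiplierCLM_apply_le {m : E → ℂ} (hm : m.HasTemperateGrowth)
    (hm2 : MemLp m 2) (w : 𝓢(E, V)) (x : E) :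
    ‖SchwartzMap.fourierMultiplierCLM V m w x‖ ≤ lpNorm m 2 volume * lpNorm w 2 volume := by
  set h : 𝓢(E, V) := SchwartzMap.smulLeftCLM V m (𝓕 w)
  have h_eq : (h : E → V) = m • ⇑(𝓕 w : 𝓢(E, V)) := SchwartzMap.smulLeftCLM_apply hm (𝓕 w)
  have apply_le : ‖SchwartzMap.fourierMultiplierCLM V m w x‖ ≤ lpNorm h 1 volume := by
    have := SchwartzMap.norm_fourier_apply_le_toLp_one h (-x)
    rw [SchwartzMap.norm_toLp, toReal_eLpNorm h.continuous.aestronglyMeasurable] at this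
    rwa [SchwartzMap.fourierMultiplierCLM_apply, SchwartzMap.fourierInv_apply_eq]
  have plancherel : lpNorm (𝓕 w : 𝓢(E, V)) 2 volume = lpNorm w 2 volume := by
    simpa only [SchwartzMap.norm_toLp,
      toReal_eLpNorm (SchwartzMap.continuous _).aestronglyMeasurable]
      using SchwartzMap.norm_fourier_toL2_eq w
  have hw := (𝓕 w : 𝓢(E, V)).memLp 2 volume
  refine apply_le.trans ?_
  rw [← plancherel, h_eq, ← toReal_eLpNorm (hm2.1.smul hw.1), ← toReal_eLpNorm hm2.1,
    ← toReal_eLpNorm hw.1, ← ENNReal.toReal_mul]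
  exact ENNReal.toReal_mono (ENNReal.mul_ne_top hm2.2.ne hw.2.ne)
    (eLpNorm_smul_le_mul_eLpNorm hw.1 hm2.1)

/-- A constant for the embeddings of `H²` into `L^∞`, of the gradient into `L⁴` and of the Hessian
into `L²`. It bounds all three explicit constants, which are `2‖ρ‖`, the square root of
`12 (2π)² ‖ρ‖` and `2 (2π)²`, where `‖ρ‖` is the `L²` norm of `resolventSymbol`. -/
noncomputable def sobolevConst (E : Type*) [NormedAddCommGroup E] [InnerProductSpace ℝ E]
    [FiniteDimensional ℝ E] [MeasurableSpace E] [BorelSpace E] : ℝ :=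
  2 * (2 * π) ^ 2 + 3 * lpNorm (resolventSymbol : E → ℂ) 2 volume

theorem sobolevConst_pos : 0 < sobolevConst E :=
  add_pos_of_pos_of_nonneg (by positivity) (mul_nonneg (by norm_num) lpNorm_nonneg)

namespace TwoJet

variable {ι : Type*} [Fintype ι] {b : OrthonormalBasis ι ℝ E} {J : TwoJet ι E V}

theorem IsH2.hasLpBound_val (hE : Module.finrank ℝ E ≤ 3) (h : J.IsH2 b) :
    HasLpBound J.val ⊤ (2 * lpNorm (resolventSymbol : E → ℂ) 2 volume * J.h2Norm) := by
  have hρ := hasTemperateGrowth_resolventSymbol (E := E)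
  have hG := h.memLp_resolventSource
  obtain ⟨H, hH⟩ := exists_schwartz_tendsto_lpNorm_sub (by simp) hG
  let F n := SchwartzMap.fourierMultiplierCLM V resolventSymbol (H n)
  have tendsto_val := tendsto_lpNorm_sub_of_fourierMultiplierCLM_eq hρ norm_resolventSymbol_le
    (fun n => (H n).memLp 2 volume) (fun n => (F n).memLp 2 volume) hG h.memLp hH
    h.fourierMultiplierCLM_resolventSource
    fun n => fourierMultiplierCLM_l2Distribution_schwartz hρ (H n)
  have tendsto_source :=
    tendsto_lpNorm_of_tendsto_lpNorm_sub one_le_two (fun n => (H n).memLp 2 volume) hG hH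
  have sup_bound n : lpNorm (F n) ⊤ volume ≤
      lpNorm (resolventSymbol : E → ℂ) 2 volume * lpNorm (H n) 2 volume :=
    lpNorm_top_le_of_forall_norm_le ((F n).memLp ⊤ volume).1
      (mul_nonneg lpNorm_nonneg lpNorm_nonneg)
      (norm_fourierMultiplierCLM_apply_le hρ (memLp_resolventSymbol hE) (H n))
  refine (HasLpBound.of_tendsto two_ne_zero (fun n => (F n).memLp 2 volume) h.memLp tendsto_val
    (tendsto_source.const_mul _) fun n => ⟨(F n).memLp ⊤ volume, sup_bound n⟩).mono ?_
  rw [mul_comm 2, mul_assoc]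
  exact mul_le_mul_of_nonneg_left h.lpNorm_resolventSource_le lpNorm_nonneg

theorem lpNorm_grad_ofSchwartz_four_le (hE : Module.finrank ℝ E ≤ 3) (f : 𝓢(E, V)) (i : ι) :
    lpNorm ((ofSchwartz b f).grad i) 4 volume ≤ sobolevConst E * (ofSchwartz b f).h2Norm := by
  let : InnerProductSpace ℝ V := .rclikeToReal ℂ V
  have h := isH2_ofSchwartz b f
  set J := ofSchwartz b f
  set r := lpNorm (resolventSymbol : E → ℂ) 2 volume with hr_def
  have hr : 0 ≤ r := lpNorm_nonneg
  refine le_of_sq_le_sq ?_ (mul_nonneg sobolevConst_pos.le J.h2Norm_nonneg)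
  calc lpNorm (J.grad i) 4 volume ^ 2
      ≤ 3 * lpNorm J.val ⊤ volume * lpNorm (J.hess i i) 2 volume :=
        lpNorm_lineDeriv_four_sq_le f (b i)
    _ ≤ 3 * (2 * r * J.h2Norm) * (2 * (2 * π) ^ 2 * J.h2Norm) := by
        have := J.h2Norm_nonneg
        exact mul_le_mul (mul_le_mul_of_nonneg_left (h.hasLpBound_val hE).lpNorm_le
          (by norm_num)) (h.lpNorm_hess_le i i) lpNorm_nonneg (by positivity)
    _ = 2 * (2 * (2 * π) ^ 2) * (3 * r) * J.h2Norm ^ 2 := by ring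
    _ ≤ (sobolevConst E * J.h2Norm) ^ 2 := by
        rw [mul_pow (sobolevConst E)]
        refine mul_le_mul_of_nonneg_right ?_ (sq_nonneg J.h2Norm)
        rw [sobolevConst, ← hr_def, add_sq]
        nlinarith [sq_nonneg (2 * (2 * π) ^ 2), sq_nonneg (3 * r)]

theorem IsH2.hasLpBound_grad (hE : Module.finrank ℝ E ≤ 3) (h : J.IsH2 b) (i : ι) :
    HasLpBound (J.grad i) 4 (sobolevConst E * J.h2Norm) := by
  obtain ⟨F, hF⟩ := h.exists_schwartz_tendstoL2
  have hF2 n := isH2_ofSchwartz b (F n)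
  exact .of_tendsto two_ne_zero (fun n => (hF2 n).memLp_grad i) (h.memLp_grad i) (hF.grad i)
    ((IsH2.tendsto_h2Norm hF2 h hF).const_mul _)
    fun n => ⟨(∂_{b i} (F n) : 𝓢(E, V)).memLp 4 volume, lpNorm_grad_ofSchwartz_four_le hE (F n) i⟩

theorem IsH2.hasSobolevBound (hE : Module.finrank ℝ E ≤ 3) (h : J.IsH2 b) :
    J.HasSobolevBound (sobolevConst E * J.h2Norm) := by
  have hρ : 0 ≤ lpNorm (resolventSymbol : E → ℂ) 2 volume := lpNorm_nonneg
  have hpi : 1 ≤ 2 * π := by linarith [Real.pi_gt_three]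
  have weaken {c : ℝ} (hc : c ≤ 2 * (2 * π) ^ 2 + 3 * lpNorm (resolventSymbol : E → ℂ) 2 volume) :
      c * J.h2Norm ≤ sobolevConst E * J.h2Norm := mul_le_mul_of_nonneg_right hc J.h2Norm_nonneg
  exact
    { val_two := ⟨h.memLp, J.lpNorm_val_le_h2Norm.trans <|
        (one_mul J.h2Norm).symm.le.trans (weaken (by nlinarith))⟩
      val_top := (h.hasLpBound_val hE).mono (weaken (by nlinarith))
      grad_two i := ⟨h.memLp_grad i, (h.lpNorm_grad_le i).trans (weaken (by nlinarith))⟩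
      grad_four := h.hasLpBound_grad hE
      hess_two i j := ⟨h.memLp_hess i j, (h.lpNorm_hess_le i j).trans (weaken (by linarith))⟩ }

end TwoJet

end SobolevEmbedding

section Nemytskii

open Filter Topology
open scoped SchwartzMap LineDeriv NNReal

theorem norm_clm_apply_sub_clm_apply_le {𝕜 G H : Type*} [NontriviallyNormedField 𝕜]
    [SeminormedAddCommGroup G] [NormedSpace 𝕜 G] [SeminormedAddCommGroup H] [NormedSpace 𝕜 H]
    (A A' : G →L[𝕜] H) (g g' : G) :
    ‖A g - A' g'‖ ≤ ‖A - A'‖ * ‖g‖ + ‖A'‖ * ‖g - g'‖ := by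
  have split : A g - A' g' = (A - A') g + A' (g - g') := by
    rw [sub_apply, map_sub, sub_add_sub_cancel]
  rw [split]
  exact norm_add_le_of_le ((A - A').le_opNorm g) (A'.le_opNorm (g - g'))

variable {ι E V W : Type*} [NormedAddCommGroup V] [NormedAddCommGroup W]

section HasLipschitzHessian

variable [NormedSpace ℝ V] [NormedSpace ℝ W]

/-- A `C²` map that vanishes to second order at the origin and whose second derivative is
`κ`-Lipschitz on the ball of radius `M` about the origin. -/
structure HasLipschitzHessian (F : V → W) (M : ℝ) (κ : ℝ≥0) : Prop where
  contDiff : ContDiff ℝ 2 F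
  map_zero : F 0 = 0
  fderiv_zero : fderiv ℝ F 0 = 0
  fderiv_fderiv_zero : fderiv ℝ (fderiv ℝ F) 0 = 0
  lipschitzOnWith : LipschitzOnWith κ (fderiv ℝ (fderiv ℝ F)) (Metric.closedBall 0 M)

namespace HasLipschitzHessian

variable {F : V → W} {M : ℝ} {κ : ℝ≥0} {u v : V}

theorem contDiff_fderiv (hF : HasLipschitzHessian F M κ) : ContDiff ℝ 1 (fderiv ℝ F) :=
  hF.contDiff.fderiv_right (by norm_num)

theorem continuous_fderiv_fderiv (hF : HasLipschitzHessian F M κ) :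
    Continuous (fderiv ℝ (fderiv ℝ F)) :=
  hF.contDiff_fderiv.continuous_fderiv one_ne_zero

theorem hasFDerivAt (hF : HasLipschitzHessian F M κ) (z : V) :
    HasFDerivAt F (fderiv ℝ F z) z :=
  (hF.contDiff.differentiable (by norm_num) z).hasFDerivAt

theorem hasFDerivAt_fderiv (hF : HasLipschitzHessian F M κ) (z : V) :
    HasFDerivAt (fderiv ℝ F) (fderiv ℝ (fderiv ℝ F) z) z :=
  (hF.contDiff_fderiv.differentiable (by norm_num) z).hasFDerivAt

theorem norm_fderiv_fderiv_sub_le (hF : HasLipschitzHessian F M κ) (hu : ‖u‖ ≤ M)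
    (hv : ‖v‖ ≤ M) :
    ‖fderiv ℝ (fderiv ℝ F) u - fderiv ℝ (fderiv ℝ F) v‖ ≤ κ * ‖u - v‖ := by
  simpa only [dist_eq_norm] using hF.lipschitzOnWith.dist_le_mul u (mem_closedBall_zero_iff.2 hu) v
    (mem_closedBall_zero_iff.2 hv)

theorem norm_fderiv_fderiv_le (hF : HasLipschitzHessian F M κ) (hu : ‖u‖ ≤ M) :
    ‖fderiv ℝ (fderiv ℝ F) u‖ ≤ κ * M := by
  have h0 : ‖(0 : V)‖ ≤ M := norm_zero.trans_le ((norm_nonneg u).trans hu)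
  simpa only [hF.fderiv_fderiv_zero, sub_zero] using
    (hF.norm_fderiv_fderiv_sub_le hu h0).trans
      (mul_le_mul_of_nonneg_left (by rwa [sub_zero]) κ.coe_nonneg)

theorem norm_fderiv_sub_le (hF : HasLipschitzHessian F M κ) (hu : ‖u‖ ≤ M) (hv : ‖v‖ ≤ M) :
    ‖fderiv ℝ F u - fderiv ℝ F v‖ ≤ κ * M * ‖u - v‖ :=
  (convex_closedBall 0 M).norm_image_sub_le_of_norm_fderiv_le
    (fun z _ => (hF.hasFDerivAt_fderiv z).differentiableAt)
    (fun _ hz => hF.norm_fderiv_fderiv_le (mem_closedBall_zero_iff.1 hz))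
    (mem_closedBall_zero_iff.2 hv) (mem_closedBall_zero_iff.2 hu)

theorem norm_fderiv_le (hF : HasLipschitzHessian F M κ) (hu : ‖u‖ ≤ M) :
    ‖fderiv ℝ F u‖ ≤ κ * M ^ 2 := by
  have hM : 0 ≤ M := (norm_nonneg u).trans hu
  have h0 : ‖(0 : V)‖ ≤ M := norm_zero.trans_le hM
  simpa only [hF.fderiv_zero, sub_zero, sq, mul_assoc] using
    (hF.norm_fderiv_sub_le hu h0).trans
      (mul_le_mul_of_nonneg_left (by rwa [sub_zero]) (mul_nonneg κ.coe_nonneg hM))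

theorem norm_sub_le (hF : HasLipschitzHessian F M κ) (hu : ‖u‖ ≤ M) (hv : ‖v‖ ≤ M) :
    ‖F u - F v‖ ≤ κ * M ^ 2 * ‖u - v‖ :=
  (convex_closedBall 0 M).norm_image_sub_le_of_norm_fderiv_le
    (fun z _ => (hF.hasFDerivAt z).differentiableAt)
    (fun _ hz => hF.norm_fderiv_le (mem_closedBall_zero_iff.1 hz))
    (mem_closedBall_zero_iff.2 hv) (mem_closedBall_zero_iff.2 hu)

theorem norm_fderiv_apply_sub_le (hF : HasLipschitzHessian F M κ) (hu : ‖u‖ ≤ M) (hv : ‖v‖ ≤ M)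
    (g g' : V) :
    ‖fderiv ℝ F u g - fderiv ℝ F v g'‖ ≤ κ * M * (‖u - v‖ * ‖g‖) + κ * M ^ 2 * ‖g - g'‖ := by
  refine (norm_clm_apply_sub_clm_apply_le _ _ g g').trans ?_
  rw [← mul_assoc]
  gcongr
  exacts [hF.norm_fderiv_sub_le hu hv, hF.norm_fderiv_le hv]

theorem norm_fderiv_fderiv_apply_sub_le (hF : HasLipschitzHessian F M κ) (hu : ‖u‖ ≤ M)
    (hv : ‖v‖ ≤ M) (g g' h h' : V) :
    ‖fderiv ℝ (fderiv ℝ F) u g h - fderiv ℝ (fderiv ℝ F) v g' h'‖ ≤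
      κ * (‖u - v‖ * (‖g‖ * ‖h‖)) + κ * M * (‖g - g'‖ * ‖h‖) + κ * M * (‖g'‖ * ‖h - h'‖) := by
  set A := fderiv ℝ (fderiv ℝ F) u
  set A' := fderiv ℝ (fderiv ℝ F) v
  have norm_A' : ‖A'‖ ≤ κ * M := hF.norm_fderiv_fderiv_le hv
  calc ‖A g h - A' g' h'‖ ≤ ‖A g - A' g'‖ * ‖h‖ + ‖A' g'‖ * ‖h - h'‖ :=
        norm_clm_apply_sub_clm_apply_le _ _ h h'
    _ ≤ (‖A - A'‖ * ‖g‖ + ‖A'‖ * ‖g - g'‖) * ‖h‖ + ‖A'‖ * ‖g'‖ * ‖h - h'‖ := by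
        gcongr
        exacts [norm_clm_apply_sub_clm_apply_le _ _ g g', A'.le_opNorm g']
    _ ≤ (κ * ‖u - v‖ * ‖g‖ + κ * M * ‖g - g'‖) * ‖h‖ + κ * M * ‖g'‖ * ‖h - h'‖ := by
        gcongr
        exact hF.norm_fderiv_fderiv_sub_le hu hv
    _ = _ := by ring

theorem const_smul (hF : HasLipschitzHessian F M κ) (c : ℝ) :
    HasLipschitzHessian (c • F) M (‖c‖₊ * κ) := by
  have fderiv_smul : fderiv ℝ (c • F) = c • fderiv ℝ F :=
    funext fun z => ((hF.hasFDerivAt z).const_smul c).fderiv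
  have fderiv_fderiv_smul : fderiv ℝ (fderiv ℝ (c • F)) = c • fderiv ℝ (fderiv ℝ F) := by
    rw [fderiv_smul]
    exact funext fun z => ((hF.hasFDerivAt_fderiv z).const_smul c).fderiv
  exact
    { contDiff := contDiff_const.smul hF.contDiff
      map_zero := by rw [Pi.smul_apply, hF.map_zero, smul_zero]
      fderiv_zero := by rw [fderiv_smul, Pi.smul_apply, hF.fderiv_zero, smul_zero]
      fderiv_fderiv_zero := by
        rw [fderiv_fderiv_smul, Pi.smul_apply, hF.fderiv_fderiv_zero, smul_zero]
      lipschitzOnWith := by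
        refine LipschitzOnWith.of_dist_le_mul fun u hu v hv => ?_
        rw [fderiv_fderiv_smul, dist_eq_norm, dist_eq_norm, NNReal.coe_mul, coe_nnnorm, mul_assoc]
        refine ((congrArg norm (smul_sub c _ _)).symm.trans_le
          (ContinuousLinearMap.opNorm_smul_le c _)).trans ?_
        gcongr
        exact hF.norm_fderiv_fderiv_sub_le (mem_closedBall_zero_iff.1 hu)
          (mem_closedBall_zero_iff.1 hv) }

end HasLipschitzHessian

end HasLipschitzHessian

theorem aestronglyMeasurable_clm_apply {α 𝕜 G H : Type*} [MeasurableSpace α] {μ : Measure α}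
    [NontriviallyNormedField 𝕜] [SeminormedAddCommGroup G] [NormedSpace 𝕜 G]
    [SeminormedAddCommGroup H] [NormedSpace 𝕜 H] {A : α → G →L[𝕜] H} {g : α → G}
    (hA : AEStronglyMeasurable A μ) (hg : AEStronglyMeasurable g μ) :
    AEStronglyMeasurable (fun x => A x (g x)) μ :=
  isBoundedBilinearMap_apply.continuous.comp_aestronglyMeasurable (hA.prodMk hg)

namespace TwoJet

variable [NormedSpace ℝ V] [NormedSpace ℝ W]

/-- The two-jet of the composition `F ∘ J.val`, given by the chain rule. -/
noncomputable def comp (F : V → W) (J : TwoJet ι E V) : TwoJet ι E W where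
  val x := F (J.val x)
  grad i x := fderiv ℝ F (J.val x) (J.grad i x)
  hess i j x := fderiv ℝ (fderiv ℝ F) (J.val x) (J.grad j x) (J.grad i x) +
    fderiv ℝ F (J.val x) (J.hess i j x)

variable {F : V → W} {R D : ℝ} {κ : ℝ≥0} {J J' : TwoJet ι E V}

theorem comp_zero (hF : F 0 = 0) : comp F (0 : TwoJet ι E V) = 0 := by
  have hess_zero (i j : ι) : (comp F (0 : TwoJet ι E V)).hess i j = 0 :=
    funext fun x => (congrArg₂ (· + ·) (map_zero _) (map_zero _)).trans (add_zero 0)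
  exact congr (congr (congrArg mk (funext fun _ => hF))
    (funext₂ fun _ _ => map_zero _)) (funext₂ hess_zero)

variable [NormedAddCommGroup E] [InnerProductSpace ℝ E] [FiniteDimensional ℝ E]
  [MeasurableSpace E] [BorelSpace E]

namespace HasSobolevBound

theorem hasLpBound_val_comp_sub (hF : HasLipschitzHessian F R κ) (h : J.HasSobolevBound R)
    (h' : J'.HasSobolevBound R) (hd : (J - J').HasSobolevBound D) :
    HasLpBound (comp F J - comp F J').val 2 (κ * R ^ 2 * D) := by
  have cont := hF.contDiff.continuous
  refine hd.val_two.of_norm_le_const_mul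
    ((cont.comp_aestronglyMeasurable h.val_two.memLp.1).sub
      (cont.comp_aestronglyMeasurable h'.val_two.memLp.1)) (by positivity) ?_
  filter_upwards [h.norm_val_le, h'.norm_val_le] with x hx hx'
  exact hF.norm_sub_le hx hx'

theorem aestronglyMeasurable_grad_comp (hF : HasLipschitzHessian F R κ) (h : J.HasSobolevBound R)
    (i : ι) : AEStronglyMeasurable ((comp F J).grad i) :=
  aestronglyMeasurable_clm_apply
    (hF.contDiff_fderiv.continuous.comp_aestronglyMeasurable h.val_two.memLp.1)
    (h.grad_two i).memLp.1

theorem aestronglyMeasurable_hess_comp (hF : HasLipschitzHessian F R κ) (h : J.HasSobolevBound R)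
    (i j : ι) : AEStronglyMeasurable ((comp F J).hess i j) :=
  (aestronglyMeasurable_clm_apply (aestronglyMeasurable_clm_apply
    (hF.continuous_fderiv_fderiv.comp_aestronglyMeasurable h.val_two.memLp.1)
    (h.grad_two j).memLp.1) (h.grad_two i).memLp.1).add
  (aestronglyMeasurable_clm_apply
    (hF.contDiff_fderiv.continuous.comp_aestronglyMeasurable h.val_two.memLp.1)
    (h.hess_two i j).memLp.1)

theorem hasLpBound_grad_comp_sub (hF : HasLipschitzHessian F R κ) (h : J.HasSobolevBound R)
    (h' : J'.HasSobolevBound R) (hd : (J - J').HasSobolevBound D) (i : ι) :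
    HasLpBound ((comp F J - comp F J').grad i) 2 (2 * (κ * R ^ 2 * D)) := by
  have hR := h.val_two.nonneg
  have val_term := (hd.val_top.norm_mul_norm (r := 2) (h.grad_two i)).const_mul
    (by positivity : 0 ≤ κ * R)
  have grad_term := (hd.grad_two i).norm.const_mul (by positivity : 0 ≤ κ * R ^ 2)
  refine ((val_term.add one_le_two grad_term).of_norm_le
    ((h.aestronglyMeasurable_grad_comp hF i).sub (h'.aestronglyMeasurable_grad_comp hF i))
    ?_).mono (by ring_nf; rfl)
  filter_upwards [h.norm_val_le, h'.norm_val_le] with x hx hx'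
  exact (hF.norm_fderiv_apply_sub_le hx hx' _ _).trans (Real.le_norm_self _)

theorem hasLpBound_hess_comp_sub (hF : HasLipschitzHessian F R κ) (h : J.HasSobolevBound R)
    (h' : J'.HasSobolevBound R) (hd : (J - J').HasSobolevBound D) (i j : ι) :
    HasLpBound ((comp F J - comp F J').hess i j) 2 (5 * (κ * R ^ 2 * D)) := by
  have hR := h.val_two.nonneg
  have hκ : 0 ≤ κ * R := by positivity
  have val_term := (hd.val_top.norm_mul_norm (r := 2)
    ((h.grad_four j).norm_mul_norm (r := 2) (h.grad_four i))).const_mul κ.coe_nonneg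
  simp only [norm_mul, norm_norm] at val_term
  have grad_term := ((hd.grad_four j).norm_mul_norm (r := 2) (h.grad_four i)).const_mul hκ
  have grad_term' := ((h'.grad_four j).norm_mul_norm (r := 2) (hd.grad_four i)).const_mul hκ
  have val_hess_term := (hd.val_top.norm_mul_norm (r := 2) (h.hess_two i j)).const_mul hκ
  have hess_term := (hd.hess_two i j).norm.const_mul (by positivity : 0 ≤ κ * R ^ 2)
  refine ((((val_term.add one_le_two grad_term).add one_le_two grad_term').add one_le_two
    (val_hess_term.add one_le_two hess_term)).of_norm_le
      ((h.aestronglyMeasurable_hess_comp hF i j).sub (h'.aestronglyMeasurable_hess_comp hF i j))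
      ?_).mono (by ring_nf; rfl)
  filter_upwards [h.norm_val_le, h'.norm_val_le] with x hx hx'
  exact ((congrArg norm (add_sub_add_comm _ _ _ _)).trans_le (norm_add_le_of_le
    (hF.norm_fderiv_fderiv_apply_sub_le hx hx' _ _ _ _)
    (hF.norm_fderiv_apply_sub_le hx hx' _ _))).trans (Real.le_norm_self _)

end HasSobolevBound

theorem HasSobolevBound.memLp_comp (hF : HasLipschitzHessian F R κ) (h : J.HasSobolevBound R) :
    MemLp (comp F J).val 2 ∧ (∀ i, MemLp ((comp F J).grad i) 2) ∧
      ∀ i j, MemLp ((comp F J).hess i j) 2 := by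
  have h0 : (0 : TwoJet ι E V).HasSobolevBound R := hasSobolevBound_zero h.val_two.nonneg
  have hd : (J - 0).HasSobolevBound R := by rwa [TwoJet.sub_zero]
  have sub_comp_zero : comp F J - comp F 0 = comp F J := by
    rw [comp_zero hF.map_zero, TwoJet.sub_zero]
  rw [← sub_comp_zero]
  exact ⟨(h.hasLpBound_val_comp_sub hF h0 hd).memLp,
    fun i => (h.hasLpBound_grad_comp_sub hF h0 hd i).memLp,
    fun i j => (h.hasLpBound_hess_comp_sub hF h0 hd i j).memLp⟩

theorem HasSobolevBound.h2Norm_comp_sub_le [Fintype ι] (hF : HasLipschitzHessian F R κ)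
    (h : J.HasSobolevBound R) (h' : J'.HasSobolevBound R) (hd : (J - J').HasSobolevBound D) :
    (comp F J - comp F J').h2Norm ≤ (1 + 5 * Fintype.card ι) * (κ * R ^ 2 * D) := by
  have hess_bound i := h.hasLpBound_hess_comp_sub hF h' hd i i
  have lap_bound : lpNorm (comp F J - comp F J').lap 2 volume ≤
      ∑ _i : ι, 5 * (κ * R ^ 2 * D) :=
    (lpNorm_sum_le (fun i _ => (hess_bound i).memLp) one_le_two).trans
      (Finset.sum_le_sum fun i _ => (hess_bound i).lpNorm_le)
  refine (h2Norm_le_add _).trans ((add_le_add (h.hasLpBound_val_comp_sub hF h' hd).lpNorm_le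
    lap_bound).trans_eq ?_)
  rw [Finset.sum_const, Finset.card_univ, nsmul_eq_mul]
  ring

end TwoJet

theorem hasLineDerivAt_comp {E : Type*} [NormedAddCommGroup E] [NormedSpace ℝ E]
    [NormedSpace ℝ V] [NormedSpace ℝ W] {F : V → W} {F' : V →L[ℝ] W} {f : E → V} {f' : V} {x v : E}
    (hF : HasFDerivAt F F' (f x)) (hf : HasLineDerivAt ℝ f f' x v) :
    HasLineDerivAt ℝ (fun y => F (f y)) (F' f') x v :=
  hF.comp_hasDerivAt_of_eq 0 hf (by simp)

namespace TwoJet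

variable [InnerProductSpace ℂ V] [InnerProductSpace ℂ W] [NormedAddCommGroup E]
  [InnerProductSpace ℝ E] [FiniteDimensional ℝ E] [MeasurableSpace E] [BorelSpace E]
  [Fintype ι] {b : OrthonormalBasis ι ℝ E} {F : V → W} {J J' : TwoJet ι E V}

theorem isH2_comp_ofSchwartz {R : ℝ} {κ : ℝ≥0} (hF : HasLipschitzHessian F R κ) {f : 𝓢(E, V)}
    (h : (ofSchwartz b f).HasSobolevBound R) : (comp F (ofSchwartz b f)).IsH2 b := by
  obtain ⟨memLp_val, memLp_grad, memLp_hess⟩ := h.memLp_comp hF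
  refine ⟨memLp_val,
    fun i => .of_hasLineDerivAt memLp_val (memLp_grad i) fun x =>
      hasLineDerivAt_comp (hF.hasFDerivAt (f x)) (hasLineDerivAt_schwartz f x (b i)),
    fun i j => .of_hasLineDerivAt (memLp_grad i) (memLp_hess i j) fun x => ?_⟩
  have hA := hasLineDerivAt_comp (hF.hasFDerivAt_fderiv (f x)) (hasLineDerivAt_schwartz f x (b j))
  have hg := hasLineDerivAt_schwartz (∂_{b i} f : 𝓢(E, V)) x (b j)
  simpa only [zero_smul, add_zero] using! HasDerivAt.clm_apply hA hg

variable [CompleteSpace V]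

theorem IsH2.h2Norm_comp_sub_le (hE : Module.finrank ℝ E ≤ 3) (h : J.IsH2 b) (h' : J'.IsH2 b)
    {s : ℝ} (hs : J.h2Norm ≤ s) (hs' : J'.h2Norm ≤ s) {κ : ℝ≥0}
    (hF : HasLipschitzHessian F (sobolevConst E * s) κ) :
    (comp F J - comp F J').h2Norm ≤ (1 + 5 * Fintype.card ι) *
      (κ * (sobolevConst E * s) ^ 2 * (sobolevConst E * (J - J').h2Norm)) :=
  have hC : 0 ≤ sobolevConst E := sobolevConst_pos.le
  ((h.hasSobolevBound hE).mono (mul_le_mul_of_nonneg_left hs hC)).h2Norm_comp_sub_le hF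
    ((h'.hasSobolevBound hE).mono (mul_le_mul_of_nonneg_left hs' hC))
    ((h.sub h').hasSobolevBound hE)

variable [CompleteSpace W]

theorem isH2_comp (hE : Module.finrank ℝ E ≤ 3) (h : J.IsH2 b)
    (hF : ∀ M, ∃ κ, HasLipschitzHessian F M κ) : (comp F J).IsH2 b := by
  obtain ⟨f, hf⟩ := h.exists_schwartz_tendstoL2
  have hK n := isH2_ofSchwartz b (f n)
  have tendsto_h2Norm := IsH2.tendsto_h2Norm hK h hf
  obtain ⟨B, hB⟩ := tendsto_h2Norm.bddAbove_range
  have h2Norm_K n : (ofSchwartz b (f n)).h2Norm ≤ B := hB (Set.mem_range_self n)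
  have h2Norm_J : J.h2Norm ≤ B := le_of_tendsto' tendsto_h2Norm h2Norm_K
  obtain ⟨κ, hκ⟩ := hF (sobolevConst E * B)
  have bound {J' : TwoJet ι E V} (h' : J'.IsH2 b) (hB' : J'.h2Norm ≤ B) :
      J'.HasSobolevBound (sobolevConst E * B) :=
    (h'.hasSobolevBound hE).mono (mul_le_mul_of_nonneg_left hB' sobolevConst_pos.le)
  have bound_K n := bound (hK n) (h2Norm_K n)
  have bound_J := bound h h2Norm_J
  have bound_sub n := ((hK n).sub h).hasSobolevBound hE
  have tendsto_sub (c : ℝ) : Tendsto (fun n => c * (κ * (sobolevConst E * B) ^ 2 *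
      (sobolevConst E * (ofSchwartz b (f n) - J).h2Norm))) atTop (𝓝 0) := by
    simpa only [mul_zero] using
      (((IsH2.tendsto_h2Norm_sub hK h hf).const_mul _).const_mul _).const_mul c
  obtain ⟨memLp_val, memLp_grad, memLp_hess⟩ := bound_J.memLp_comp hκ
  refine .of_tendstoL2 (fun n => isH2_comp_ofSchwartz hκ (bound_K n)) memLp_val memLp_grad
    memLp_hess ⟨?_, fun i => ?_, fun i j => ?_⟩
  · refine squeeze_zero (fun n => lpNorm_nonneg) (fun n => ?_) (tendsto_sub 1)
    rw [one_mul]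
    exact ((bound_K n).hasLpBound_val_comp_sub hκ bound_J (bound_sub n)).lpNorm_le
  · exact squeeze_zero (fun n => lpNorm_nonneg) (fun n =>
      ((bound_K n).hasLpBound_grad_comp_sub hκ bound_J (bound_sub n) i).lpNorm_le) (tendsto_sub 2)
  · exact squeeze_zero (fun n => lpNorm_nonneg) (fun n =>
      ((bound_K n).hasLpBound_hess_comp_sub hκ bound_J (bound_sub n) i j).lpNorm_le) (tendsto_sub 5)

end TwoJet

end Nemytskii

section PowerMap

open Filter Topology NormedSpace
open scoped NNReal

section NormedSpace

variable {V X : Type*} [NormedAddCommGroup V] [NormedSpace ℝ V] [NormedAddCommGroup X]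
  [NormedSpace ℝ X] {b s A M : ℝ}

/-- The power map `z ↦ |z|^b z`, with `0 ^ 0 = 1`. -/
noncomputable def powerMap (b : ℝ) (z : V) : V := ‖z‖ ^ b • z

theorem powerMap_zero_right (b : ℝ) : powerMap b (0 : V) = 0 := smul_zero _

theorem norm_normalize_le_one (z : V) : ‖normalize z‖ ≤ 1 := by
  obtain rfl | hz := eq_or_ne z 0
  · rw [normalize_zero_eq_zero, norm_zero]
    exact zero_le_one
  · exact (norm_normalize_eq_one_iff.2 hz).le

theorem norm_mul_norm_normalize_sub_le (z w : V) :
    ‖w‖ * ‖normalize z - normalize w‖ ≤ 2 * ‖z - w‖ := by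
  have split : ‖w‖ • (normalize z - normalize w) = (‖w‖ - ‖z‖) • normalize z + (z - w) := by
    rw [smul_sub, sub_smul, norm_smul_normalize, norm_smul_normalize]
    abel
  have radial : ‖(‖w‖ - ‖z‖) • normalize z‖ ≤ ‖z - w‖ := by
    rw [norm_smul, norm_sub_rev z]
    exact (mul_le_of_le_one_right (norm_nonneg _) (norm_normalize_le_one z)).trans
      (abs_norm_sub_norm_le w z)
  calc ‖w‖ * ‖normalize z - normalize w‖ = ‖‖w‖ • (normalize z - normalize w)‖ := by
        rw [norm_smul, norm_norm]
    _ ≤ 2 * ‖z - w‖ := by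
        rw [split, two_mul]
        exact norm_add_le_of_le radial le_rfl

theorem abs_norm_rpow_sub_norm_rpow_le {V : Type*} [NormedAddCommGroup V] (hs : 1 ≤ s)
    {z w : V} (hz : ‖z‖ ≤ M) (hw : ‖w‖ ≤ M) :
    |‖z‖ ^ s - ‖w‖ ^ s| ≤ s * M ^ (s - 1) * ‖z - w‖ := by
  have deriv_le (t : ℝ) (ht : t ∈ Set.Icc 0 M) : ‖s * t ^ (s - 1)‖ ≤ s * M ^ (s - 1) := by
    rw [Real.norm_of_nonneg (mul_nonneg (by positivity) (Real.rpow_nonneg ht.1 _))]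
    have := Real.rpow_le_rpow ht.1 ht.2 (sub_nonneg.2 hs)
    gcongr
  have hM : 0 ≤ M := (norm_nonneg z).trans hz
  calc |‖z‖ ^ s - ‖w‖ ^ s| ≤ s * M ^ (s - 1) * ‖‖z‖ - ‖w‖‖ :=
        (convex_Icc 0 M).norm_image_sub_le_of_norm_hasDerivWithin_le
          (fun t _ => (Real.hasDerivAt_rpow_const (.inr hs)).hasDerivWithinAt) deriv_le
          ⟨norm_nonneg w, hw⟩ ⟨norm_nonneg z, hz⟩
    _ ≤ s * M ^ (s - 1) * ‖z - w‖ := by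
        gcongr
        exact abs_norm_sub_norm_le z w

theorem norm_norm_rpow_smul_normalize_sub_le {B : ℝ} {T : V → X} (hs : 1 ≤ s)
    (hT : ∀ e, ‖e‖ ≤ 1 → ‖T e‖ ≤ A)
    (hT_lipschitz : ∀ e f, ‖e‖ ≤ 1 → ‖f‖ ≤ 1 → ‖T e - T f‖ ≤ B * ‖e - f‖)
    {z w : V} (hz : ‖z‖ ≤ M) (hw : ‖w‖ ≤ M) (hB : 0 ≤ B) :
    ‖‖z‖ ^ s • T (normalize z) - ‖w‖ ^ s • T (normalize w)‖ ≤
      (s * A + 2 * B) * M ^ (s - 1) * ‖z - w‖ := by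
  have hM : 0 ≤ M := (norm_nonneg z).trans hz
  have split : ‖z‖ ^ s • T (normalize z) - ‖w‖ ^ s • T (normalize w) =
      (‖z‖ ^ s - ‖w‖ ^ s) • T (normalize z) + ‖w‖ ^ s • (T (normalize z) - T (normalize w)) := by
    rw [sub_smul, smul_sub, sub_add_sub_cancel]
  have radial : ‖(‖z‖ ^ s - ‖w‖ ^ s) • T (normalize z)‖ ≤ s * M ^ (s - 1) * ‖z - w‖ * A := by
    rw [norm_smul]
    exact mul_le_mul (abs_norm_rpow_sub_norm_rpow_le hs hz hw)
      (hT _ (norm_normalize_le_one z)) (norm_nonneg _) (by positivity)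
  have angular : ‖‖w‖ ^ s • (T (normalize z) - T (normalize w))‖ ≤
      M ^ (s - 1) * (B * (2 * ‖z - w‖)) := by
    calc ‖‖w‖ ^ s • (T (normalize z) - T (normalize w))‖
        = ‖w‖ ^ (s - 1) * (‖w‖ * ‖T (normalize z) - T (normalize w)‖) := by
          rw [norm_smul, Real.norm_of_nonneg (by positivity), ← mul_assoc,
            ← Real.rpow_add_one' (norm_nonneg w) (by linarith), sub_add_cancel]
      _ ≤ ‖w‖ ^ (s - 1) * (‖w‖ * (B * ‖normalize z - normalize w‖)) := by
          gcongr
          exact hT_lipschitz _ _ (norm_normalize_le_one z) (norm_normalize_le_one w)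
      _ = ‖w‖ ^ (s - 1) * (B * (‖w‖ * ‖normalize z - normalize w‖)) := by ring
      _ ≤ M ^ (s - 1) * (B * (2 * ‖z - w‖)) := by
          exact mul_le_mul (Real.rpow_le_rpow (norm_nonneg w) hw (sub_nonneg.2 hs))
            (mul_le_mul_of_nonneg_left (norm_mul_norm_normalize_sub_le z w) hB)
            (by positivity) (by positivity)
  rw [split]
  exact (norm_add_le_of_le radial angular).trans_eq (by ring)

theorem powerMap_eq_smul_normalize (hb : 0 ≤ b) (z : V) :
    powerMap b z = ‖z‖ ^ (b + 1) • normalize z := by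
  rw [powerMap, Real.rpow_add_one' (norm_nonneg z) (by positivity), mul_smul, norm_smul_normalize]

theorem norm_powerMap_sub_le (hb : 0 ≤ b) {z w : V} (hz : ‖z‖ ≤ M) (hw : ‖w‖ ≤ M) :
    ‖powerMap b z - powerMap b w‖ ≤ (b + 3) * M ^ b * ‖z - w‖ := by
  rw [powerMap_eq_smul_normalize hb, powerMap_eq_smul_normalize hb]
  refine (norm_norm_rpow_smul_normalize_sub_le (T := id) (A := 1) (B := 1) (by linarith)
    (fun e he => he) (fun e f _ _ => (one_mul _).ge) hz hw zero_le_one).trans_eq ?_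
  ring_nf

end NormedSpace

section InnerProductSpace

variable {V : Type*} [NormedAddCommGroup V] [InnerProductSpace ℝ V] {b M : ℝ}

theorem hasFDerivAt_powerMap_of_one_lt (hb : 1 < b) (z : V) :
    HasFDerivAt (powerMap b)
      (‖z‖ ^ b • .id ℝ V + b • (innerSL ℝ (powerMap (b - 2) z)).smulRight z) z := by
  refine ((hasFDerivAt_norm_rpow z hb).smul (hasFDerivAt_id z)).congr_fderiv ?_
  ext v
  simp [powerMap, mul_smul]

theorem hasFDerivAt_norm_rpow_of_ne_zero (b : ℝ) {z : V} (hz : z ≠ 0) :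
    HasFDerivAt (fun y : V => ‖y‖ ^ b) ((b * ‖z‖ ^ (b - 2)) • innerSL ℝ z) z := by
  have norm_rpow (y : V) (s : ℝ) : (‖y‖ ^ 2) ^ s = ‖y‖ ^ (2 * s) := by
    rw [← Real.rpow_natCast_mul (norm_nonneg y), Nat.cast_ofNat]
  have := ((hasStrictFDerivAt_norm_sq z).rpow_const (p := b / 2) (by simp [hz])).hasFDerivAt
  simp only [norm_rpow, ← Nat.cast_smul_eq_nsmul ℝ, smul_smul] at this
  convert this using 2 <;> ring_nf

theorem hasFDerivAt_powerMap_of_ne_zero (b : ℝ) {z : V} (hz : z ≠ 0) :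
    HasFDerivAt (powerMap b)
      (‖z‖ ^ b • .id ℝ V +
        (b * ‖z‖ ^ b) • (innerSL ℝ (normalize z)).smulRight (normalize z)) z := by
  refine ((hasFDerivAt_norm_rpow_of_ne_zero b hz).smul (hasFDerivAt_id z)).congr_fderiv ?_
  ext v
  have norm_rpow : ‖z‖ ^ (b - 2) = ‖z‖ ^ b * (‖z‖⁻¹ * ‖z‖⁻¹) := by
    rw [Real.rpow_sub (norm_pos_iff.2 hz), Real.rpow_two, div_eq_mul_inv, sq, mul_inv]
  simp only [norm_rpow, NormedSpace.normalize, real_inner_smul_left, _root_.add_apply,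
    _root_.smul_apply, ContinuousLinearMap.smulRight_apply, innerSL_apply_apply, smul_eq_mul, id]
  module

theorem hasFDerivAt_powerMap_zero (hb : 0 < b) :
    HasFDerivAt (powerMap b) (0 : V →L[ℝ] V) 0 := by
  have tendsto_norm_rpow : Tendsto (fun z : V => ‖z‖ ^ b) (𝓝 0) (𝓝 0) := by
    simpa [hb.ne'] using (continuous_norm.rpow_const fun _ => .inr hb.le).tendsto (0 : V)
  refine .of_isLittleO ?_
  simpa [powerMap] using! ((Asymptotics.isLittleO_one_iff ℝ).2 tendsto_norm_rpow).smul_isBigO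
    (Asymptotics.isBigO_refl (fun z : V => z) (𝓝 0))

theorem hasFDerivAt_powerMap (hb : 0 ≤ b) (z : V) :
    HasFDerivAt (powerMap b)
      (‖z‖ ^ b • .id ℝ V +
        (b * ‖z‖ ^ b) • (innerSL ℝ (normalize z)).smulRight (normalize z)) z := by
  obtain rfl | hz := eq_or_ne z 0
  · obtain rfl | hb := hb.eq_or_lt
    · have powerMap_zero_left : powerMap 0 = (id : V → V) := funext fun z => by simp [powerMap]
      simpa [powerMap_zero_left] using hasFDerivAt_id (𝕜 := ℝ) (0 : V)
    · simpa [hb.ne'] using hasFDerivAt_powerMap_zero hb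
  · exact hasFDerivAt_powerMap_of_ne_zero b hz

/-- The Hessian of `powerMap b` at a unit vector `e`, applied to `w` and `v`. -/
noncomputable def powerMapHessian (b : ℝ) (w v e : V) : V :=
  b • (inner ℝ e w • v + inner ℝ (w + ((b - 2) * inner ℝ e w) • e) v • e + inner ℝ e v • w)

theorem fderiv_powerMap (hb : 1 < b) :
    fderiv ℝ (powerMap b : V → V) =
      fun z => ‖z‖ ^ b • .id ℝ V + b • (innerSL ℝ (powerMap (b - 2) z)).smulRight z :=
  funext fun z => (hasFDerivAt_powerMap_of_one_lt hb z).fderiv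

theorem exists_hasFDerivAt_fderiv_powerMap (hb : 2 ≤ b) (z : V) :
    ∃ D : V →L[ℝ] V →L[ℝ] V, HasFDerivAt (fderiv ℝ (powerMap b)) D z ∧
      ∀ w v, D w v = ‖z‖ ^ (b - 1) • powerMapHessian b w v (normalize z) := by
  have hasFDerivAt_innerSL := (innerSL ℝ (E := V)).hasFDerivAt.comp z
    (hasFDerivAt_powerMap (sub_nonneg.2 hb) z)
  have hasFDerivAt_smulRight := (ContinuousLinearMap.smulRightL ℝ V V).hasFDerivAt_of_bilinear
    hasFDerivAt_innerSL (hasFDerivAt_id z)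
  have hasFDerivAt_norm := (hasFDerivAt_norm_rpow z (p := b) (by linarith)).smul_const
    (ContinuousLinearMap.id ℝ V)
  rw [fderiv_powerMap (by linarith)]
  refine ⟨_, hasFDerivAt_norm.add (hasFDerivAt_smulRight.const_smul b), fun w v => ?_⟩
  have powerMap_eq : powerMap (b - 2) z = ‖z‖ ^ (b - 1) • normalize z := by
    rw [powerMap_eq_smul_normalize (sub_nonneg.2 hb), sub_add]
    norm_num
  have z_eq : z = ‖z‖ • normalize z := (norm_smul_normalize z).symm
  have norm_rpow : ‖z‖ ^ (b - 1) = ‖z‖ ^ (b - 2) * ‖z‖ := by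
    rw [← Real.rpow_add_one' (norm_nonneg z) (by linarith)]
    ring_nf
  simp only [Function.comp_apply, powerMap_eq, norm_rpow, powerMapHessian, id, smul_eq_mul,
    _root_.add_apply, _root_.smul_apply, ContinuousLinearMap.comp_apply,
    ContinuousLinearMap.precompR_apply, ContinuousLinearMap.precompL_apply,
    ContinuousLinearMap.compL_apply, ContinuousLinearMap.smulRightL_apply_apply,
    ContinuousLinearMap.smulRight_apply, ContinuousLinearMap.id_apply, innerSL_apply_apply]
  rw [innerSL_apply_apply, innerSL_apply_apply]
  generalize normalize z = e at z_eq ⊢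
  generalize ‖z‖ = r at z_eq ⊢
  simp only [z_eq, inner_add_left, real_inner_smul_left]
  module

theorem differentiable_fderiv_powerMap (hb : 2 ≤ b) :
    Differentiable ℝ (fderiv ℝ (powerMap b : V → V)) := fun z =>
  let ⟨_, hD, _⟩ := exists_hasFDerivAt_fderiv_powerMap hb z
  hD.differentiableAt

theorem fderiv_fderiv_powerMap_apply (hb : 2 ≤ b) (z w v : V) :
    fderiv ℝ (fderiv ℝ (powerMap b)) z w v =
      ‖z‖ ^ (b - 1) • powerMapHessian b w v (normalize z) := by
  obtain ⟨D, hD, D_apply⟩ := exists_hasFDerivAt_fderiv_powerMap hb z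
  rw [hD.fderiv, D_apply]

theorem norm_inner_smul_le (u w v : V) : ‖inner ℝ u w • v‖ ≤ ‖u‖ * ‖w‖ * ‖v‖ := by
  rw [norm_smul]
  exact mul_le_mul_of_nonneg_right (norm_inner_le_norm u w) (norm_nonneg v)

theorem norm_add_inner_smul_le (hb : 2 ≤ b) (w : V) {e : V} (he : ‖e‖ ≤ 1) :
    ‖w + ((b - 2) * inner ℝ e w) • e‖ ≤ (b - 1) * ‖w‖ := by
  have rank_one : ‖((b - 2) * inner ℝ e w) • e‖ ≤ (b - 2) * ‖w‖ := by
    rw [mul_smul, norm_smul, Real.norm_of_nonneg (sub_nonneg.2 hb)]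
    refine mul_le_mul_of_nonneg_left ?_ (sub_nonneg.2 hb)
    calc ‖inner ℝ e w • e‖ ≤ ‖e‖ * ‖w‖ * ‖e‖ := norm_inner_smul_le e w e
      _ ≤ 1 * ‖w‖ * 1 := by gcongr
      _ = ‖w‖ := by ring
  exact (norm_add_le_of_le le_rfl rank_one).trans_eq (by ring)

theorem norm_inner_smul_self_sub_le (w : V) {e f : V} (he : ‖e‖ ≤ 1) (hf : ‖f‖ ≤ 1) :
    ‖inner ℝ e w • e - inner ℝ f w • f‖ ≤ 2 * ‖w‖ * ‖e - f‖ := by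
  have split : inner ℝ e w • e - inner ℝ f w • f =
      inner ℝ (e - f) w • e + inner ℝ f w • (e - f) := by
    rw [inner_sub_left]
    module
  calc ‖inner ℝ e w • e - inner ℝ f w • f‖
      ≤ ‖e - f‖ * ‖w‖ * ‖e‖ + ‖f‖ * ‖w‖ * ‖e - f‖ := by
        rw [split]
        exact norm_add_le_of_le (norm_inner_smul_le _ _ _) (norm_inner_smul_le _ _ _)
    _ ≤ ‖e - f‖ * ‖w‖ * 1 + 1 * ‖w‖ * ‖e - f‖ := by gcongr
    _ = 2 * ‖w‖ * ‖e - f‖ := by ring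

theorem norm_powerMapHessian_le (hb : 2 ≤ b) (w v : V) {e : V} (he : ‖e‖ ≤ 1) :
    ‖powerMapHessian b w v e‖ ≤ b * (b + 1) * (‖w‖ * ‖v‖) := by
  have hb' : 0 ≤ b - 1 := by linarith
  rw [powerMapHessian, norm_smul, Real.norm_of_nonneg (by linarith), mul_assoc b]
  gcongr
  calc _ ≤ ‖e‖ * ‖w‖ * ‖v‖ + ‖w + ((b - 2) * inner ℝ e w) • e‖ * ‖v‖ * ‖e‖ + ‖e‖ * ‖v‖ * ‖w‖ :=
        norm_add₃_le.trans (by gcongr <;> exact norm_inner_smul_le _ _ _)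
    _ ≤ 1 * ‖w‖ * ‖v‖ + (b - 1) * ‖w‖ * ‖v‖ * 1 + 1 * ‖v‖ * ‖w‖ := by
        gcongr
        exact norm_add_inner_smul_le hb w he
    _ = (b + 1) * (‖w‖ * ‖v‖) := by ring

theorem norm_powerMapHessian_sub_le (hb : 2 ≤ b) (w v : V) {e f : V} (he : ‖e‖ ≤ 1)
    (hf : ‖f‖ ≤ 1) :
    ‖powerMapHessian b w v e - powerMapHessian b w v f‖ ≤
      3 * b * (b - 1) * (‖w‖ * ‖v‖) * ‖e - f‖ := by
  have hb' : 0 ≤ b - 2 := sub_nonneg.2 hb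
  let L (u : V) : V := w + ((b - 2) * inner ℝ u w) • u
  have norm_L_sub_le : ‖L e - L f‖ ≤ (b - 2) * (2 * ‖w‖ * ‖e - f‖) := by
    rw [add_sub_add_left_eq_sub, mul_smul, mul_smul, ← smul_sub, norm_smul,
      Real.norm_of_nonneg hb']
    exact mul_le_mul_of_nonneg_left (norm_inner_smul_self_sub_le w he hf) hb'
  have split : powerMapHessian b w v e - powerMapHessian b w v f =
      b • (inner ℝ (e - f) w • v + inner ℝ (L e - L f) v • e + inner ℝ (L f) v • (e - f) +
        inner ℝ (e - f) v • w) := by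
    rw [powerMapHessian, powerMapHessian, inner_sub_left, inner_sub_left, inner_sub_left]
    module
  rw [split, norm_smul, Real.norm_of_nonneg (by linarith)]
  calc _ ≤ b * (‖e - f‖ * ‖w‖ * ‖v‖ + ‖L e - L f‖ * ‖v‖ * ‖e‖ + ‖L f‖ * ‖v‖ * ‖e - f‖ +
          ‖e - f‖ * ‖v‖ * ‖w‖) := by
        gcongr
        exact norm_add₄_le.trans (by gcongr <;> exact norm_inner_smul_le _ _ _)
    _ ≤ b * (‖e - f‖ * ‖w‖ * ‖v‖ + (b - 2) * (2 * ‖w‖ * ‖e - f‖) * ‖v‖ * 1 +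
          (b - 1) * ‖w‖ * ‖v‖ * ‖e - f‖ + ‖e - f‖ * ‖v‖ * ‖w‖) := by
        gcongr
        exact norm_add_inner_smul_le hb w hf
    _ = 3 * b * (b - 1) * (‖w‖ * ‖v‖) * ‖e - f‖ := by ring

theorem norm_fderiv_fderiv_powerMap_sub_le (hb : 2 ≤ b) {z w : V} (hz : ‖z‖ ≤ M)
    (hw : ‖w‖ ≤ M) :
    ‖fderiv ℝ (fderiv ℝ (powerMap b)) z - fderiv ℝ (fderiv ℝ (powerMap b)) w‖ ≤
      b * (b - 1) * (b + 7) * M ^ (b - 2) * ‖z - w‖ := by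
  have hM : 0 ≤ M := (norm_nonneg z).trans hz
  have hb' : 0 ≤ b - 1 := by linarith
  refine ContinuousLinearMap.opNorm_le_bound₂ _ (by positivity) fun x y => ?_
  rw [_root_.sub_apply, _root_.sub_apply, fderiv_fderiv_powerMap_apply hb,
    fderiv_fderiv_powerMap_apply hb]
  refine (norm_norm_rpow_smul_normalize_sub_le (by linarith)
    (fun e he => norm_powerMapHessian_le hb x y he)
    (fun e f he hf => norm_powerMapHessian_sub_le hb x y he hf) hz hw
    (by positivity)).trans_eq ?_
  ring_nf

theorem lipschitzOnWith_fderiv_fderiv_powerMap (hb : 2 ≤ b) (M : ℝ) :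
    LipschitzOnWith (b * (b - 1) * (b + 7) * M ^ (b - 2)).toNNReal
      (fderiv ℝ (fderiv ℝ (powerMap b : V → V))) (Metric.closedBall 0 M) :=
  .of_dist_le' fun z hz w hw => by
    rw [dist_eq_norm, dist_eq_norm]
    exact norm_fderiv_fderiv_powerMap_sub_le hb (mem_closedBall_zero_iff.1 hz)
      (mem_closedBall_zero_iff.1 hw)

theorem continuous_fderiv_fderiv_powerMap (hb : 2 ≤ b) :
    Continuous (fderiv ℝ (fderiv ℝ (powerMap b : V → V))) :=
  LocallyLipschitz.continuous fun z =>
    ⟨_, _, Metric.closedBall_mem_nhds_of_mem (mem_ball_zero_iff.2 (lt_add_one ‖z‖)),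
      lipschitzOnWith_fderiv_fderiv_powerMap hb (‖z‖ + 1)⟩

theorem contDiff_powerMap (hb : 2 ≤ b) : ContDiff ℝ 2 (powerMap b : V → V) := by
  rw [← one_add_one_eq_two, contDiff_succ_iff_fderiv]
  exact ⟨fun z => (hasFDerivAt_powerMap (by linarith) z).differentiableAt, by simp,
    contDiff_one_iff_fderiv.2
      ⟨differentiable_fderiv_powerMap hb, continuous_fderiv_fderiv_powerMap hb⟩⟩

theorem hasLipschitzHessian_powerMap (hb : 2 ≤ b) (M : ℝ) :
    HasLipschitzHessian (powerMap b : V → V) M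
      (b * (b - 1) * (b + 7) * M ^ (b - 2)).toNNReal where
  contDiff := contDiff_powerMap hb
  map_zero := powerMap_zero_right b
  fderiv_zero := (hasFDerivAt_powerMap_zero (by linarith)).fderiv
  fderiv_fderiv_zero := by
    ext w v
    rw [fderiv_fderiv_powerMap_apply hb, norm_zero, Real.zero_rpow (by linarith), zero_smul]
    rfl
  lipschitzOnWith := lipschitzOnWith_fderiv_fderiv_powerMap hb M

end InnerProductSpace

end PowerMap

section TestFunctions

open Filter Topology
open scoped SchwartzMap LineDeriv ContDiff

section Cutoff

variable {E : Type*} [NormedAddCommGroup E] [InnerProductSpace ℝ E] [FiniteDimensional ℝ E]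

/-- Smooth compactly supported functions with values in `[0, 1]` that exhaust `E`: the dilations
of a fixed bump function by the factors `n + 1`. -/
noncomputable def cutoff (n : ℕ) (x : E) : ℝ :=
  (⟨1, 2, one_pos, one_lt_two⟩ : ContDiffBump (0 : E)) ((n + 1 : ℝ)⁻¹ • x)

theorem contDiff_cutoff (n : ℕ) : ContDiff ℝ ∞ (cutoff n : E → ℝ) :=
  (ContDiffBump.contDiff _).comp (contDiff_const_smul _)

theorem hasCompactSupport_cutoff (n : ℕ) : HasCompactSupport (cutoff n : E → ℝ) :=
  (ContDiffBump.hasCompactSupport _).comp_smul (inv_ne_zero n.cast_add_one_ne_zero)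

theorem norm_cutoff_le_one (n : ℕ) (x : E) : ‖cutoff n x‖ ≤ 1 :=
  (Real.norm_of_nonneg (ContDiffBump.nonneg _)).trans_le (ContDiffBump.le_one _)

theorem tendsto_inv_nat_add_one : Tendsto (fun n : ℕ => (n + 1 : ℝ)⁻¹) atTop (𝓝 0) := by
  simpa only [one_div] using tendsto_one_div_add_atTop_nhds_zero_nat (𝕜 := ℝ)

theorem tendsto_cutoff (x : E) : Tendsto (fun n => cutoff n x) atTop (𝓝 1) := by
  set bump : ContDiffBump (0 : E) := ⟨1, 2, one_pos, one_lt_two⟩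
  have bump_zero : bump ((0 : ℝ) • x) = 1 := by
    rw [zero_smul]
    exact bump.one_of_mem_closedBall (Metric.mem_closedBall_self zero_le_one)
  rw [← bump_zero]
  exact (bump.continuous.tendsto _).comp (tendsto_inv_nat_add_one.smul_const x)

theorem exists_norm_fderiv_cutoff_apply_le (v : E) :
    ∃ C, ∀ (n : ℕ) (x : E), ‖fderiv ℝ (cutoff n) x v‖ ≤ (n + 1 : ℝ)⁻¹ * C := by
  set bump : ContDiffBump (0 : E) := ⟨1, 2, one_pos, one_lt_two⟩
  obtain ⟨C, hC⟩ := (bump.hasCompactSupport.fderiv_apply ℝ v).exists_bound_of_continuous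
    ((bump.contDiff.continuous_fderiv one_ne_zero).clm_apply continuous_const)
  refine ⟨C, fun n x => ?_⟩
  have chain : fderiv ℝ (cutoff n) x = (n + 1 : ℝ)⁻¹ • fderiv ℝ bump ((n + 1 : ℝ)⁻¹ • x) :=
    fderiv_comp_smul _
  rw [chain, _root_.smul_apply, norm_smul, Real.norm_of_nonneg (by positivity)]
  gcongr
  exact hC _

end Cutoff

theorem tendsto_integral_smul_of_norm_le {α V : Type*} [MeasurableSpace α] {μ : Measure α}
    [NormedAddCommGroup V] [NormedSpace ℝ V] {c : ℕ → α → ℝ} {l B : ℝ} {u : α → V}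
    (hc : ∀ n, AEStronglyMeasurable (c n) μ) (hB : ∀ n x, ‖c n x‖ ≤ B)
    (hl : ∀ x, Tendsto (fun n => c n x) atTop (𝓝 l)) (hu : Integrable u μ) :
    Tendsto (fun n => ∫ x, c n x • u x ∂μ) atTop (𝓝 (l • ∫ x, u x ∂μ)) := by
  rw [← integral_smul]
  refine tendsto_integral_of_dominated_convergence (fun x => B * ‖u x‖)
    (fun n => (hc n).smul hu.1) (hu.norm.const_mul B) (fun n => .of_forall fun x => ?_)
    (.of_forall fun x => (hl x).smul_const (u x))
  rw [norm_smul]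
  gcongr
  exact hB n x

variable {E V : Type*} [NormedAddCommGroup E] [InnerProductSpace ℝ E]

theorem lineDeriv_schwartz_of_eq_smul [NormedAddCommGroup V] [NormedSpace ℝ V] {χ : E → ℝ}
    {φ ψ : 𝓢(E, V)} (hψ : ⇑ψ = χ • ⇑φ) (hχ : Differentiable ℝ χ) (v x : E) :
    (∂_{v} ψ) x = χ x • (∂_{v} φ) x + fderiv ℝ χ x v • φ x := by
  rw [SchwartzMap.lineDerivOp_apply_eq_fderiv, SchwartzMap.lineDerivOp_apply_eq_fderiv, hψ]
  exact congrArg (· v) ((hχ x).hasFDerivAt.smul (φ.hasFDerivAt x)).fderiv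

theorem clm_lineDeriv_schwartz {W : Type*} [NormedAddCommGroup W] [NormedSpace ℝ W]
    (L : ℂ →L[ℝ] W) (φ : 𝓢(E, ℂ)) (v x : E) :
    L ((∂_{v} φ) x) = fderiv ℝ (fun y => L (φ y)) x v := by
  rw [SchwartzMap.lineDerivOp_apply_eq_fderiv]
  exact congrArg (· v) (L.hasFDerivAt.comp x (φ.hasFDerivAt x)).fderiv.symm

variable [FiniteDimensional ℝ E] [MeasurableSpace E] [BorelSpace E] [NormedAddCommGroup V]
  [InnerProductSpace ℂ V] {v : E} {f g : E → V}

theorem integrable_smul_of_hasCompactSupport {χ : E → ℝ} (hχ : Continuous χ)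
    (hc : HasCompactSupport χ) (hf : MemLp f 2) : Integrable (fun x => χ x • f x) :=
  (hf.locallyIntegrable one_le_two).integrable_smul_left_of_hasCompactSupport hχ hc

theorem integral_cutoff_smul_lineDeriv (hf : MemLp f 2)
    (h : ∀ φ : 𝓢(E, ℂ), HasCompactSupport φ → ∫ x, (∂_{v} φ) x • f x = -∫ x, φ x • g x)
    (φ : 𝓢(E, ℂ)) {χ : E → ℝ} (hχ : ContDiff ℝ ∞ χ) (hc : HasCompactSupport χ) :
    (∫ x, χ x • (∂_{v} φ) x • f x) + ∫ x, fderiv ℝ χ x v • φ x • f x =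
      -∫ x, χ x • φ x • g x := by
  have integrable_smul {c : E → ℝ} (hc : Continuous c) (hc' : HasCompactSupport c)
      (ψ : 𝓢(E, ℂ)) : Integrable fun x => c x • ψ x • f x :=
    (integrable_schwartz_smul ψ hf).locallyIntegrable.integrable_smul_left_of_hasCompactSupport
      hc hc'
  rw [← integral_add (integrable_smul hχ.continuous hc _)
    (integrable_smul ((hχ.continuous_fderiv (by simp)).clm_apply continuous_const)
      (hc.fderiv_apply ℝ v) φ)]
  have hc_smul : HasCompactSupport (χ • ⇑φ) := hc.smul_right
  let ψ : 𝓢(E, ℂ) := hc_smul.toSchwartzMap (hχ.smul (φ.smooth ⊤))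
  have ψ_eq : ⇑ψ = χ • ⇑φ := rfl
  have parts := h ψ hc_smul
  simpa only [lineDeriv_schwartz_of_eq_smul ψ_eq (hχ.differentiable (by simp)), ψ_eq,
    Pi.smul_apply', add_smul, smul_assoc] using parts

theorem hasL2LineDeriv_of_hasCompactSupport (hf : MemLp f 2) (hg : MemLp g 2)
    (h : ∀ φ : 𝓢(E, ℂ), HasCompactSupport φ → ∫ x, (∂_{v} φ) x • f x = -∫ x, φ x • g x) :
    HasL2LineDeriv v f g := by
  refine ⟨hf, hg, fun φ => ?_⟩
  obtain ⟨C, hC⟩ := exists_norm_fderiv_cutoff_apply_le v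
  have hC0 : 0 ≤ C := by simpa using (norm_nonneg _).trans (hC 0 0)
  have fderiv_le n x : ‖fderiv ℝ (cutoff n) x v‖ ≤ C :=
    (hC n x).trans (mul_le_of_le_one_left hC0 (inv_le_one_of_one_le₀ (by simp)))
  have tendsto_fderiv x : Tendsto (fun n => fderiv ℝ (cutoff n) x v) atTop (𝓝 0) :=
    squeeze_zero_norm (hC · x) (by simpa only [zero_mul] using tendsto_inv_nat_add_one.mul_const C)
  have measurable_cutoff n : AEStronglyMeasurable (cutoff n : E → ℝ) :=
    (contDiff_cutoff n).continuous.aestronglyMeasurable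
  have measurable_fderiv n : AEStronglyMeasurable (fun x : E => fderiv ℝ (cutoff n) x v) :=
    ((contDiff_cutoff n).continuous_fderiv (by simp)).clm_apply continuous_const
      |>.aestronglyMeasurable
  have limit_f := (tendsto_integral_smul_of_norm_le measurable_cutoff norm_cutoff_le_one
    tendsto_cutoff (integrable_schwartz_smul (∂_{v} φ : 𝓢(E, ℂ)) hf)).add
    (tendsto_integral_smul_of_norm_le measurable_fderiv fderiv_le tendsto_fderiv
      (integrable_schwartz_smul φ hf))
  have limit_g := (tendsto_integral_smul_of_norm_le measurable_cutoff norm_cutoff_le_one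
    tendsto_cutoff (integrable_schwartz_smul φ hg)).neg
  simpa only [one_smul, zero_smul, add_zero] using tendsto_nhds_unique (limit_f.congr fun n =>
    integral_cutoff_smul_lineDeriv hf h φ (contDiff_cutoff n) (hasCompactSupport_cutoff n)) limit_g

theorem complex_smul_eq_re_smul_add_I_smul (z : ℂ) (w : V) :
    z • w = z.re • w + Complex.I • z.im • w := by
  conv_lhs => rw [← Complex.re_add_im z, mul_comm, add_smul, mul_smul]
  simp only [Complex.coe_smul]

theorem integral_complex_smul {φ : E → ℂ} (hre : Integrable fun x => (φ x).re • f x)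
    (him : Integrable fun x => (φ x).im • f x) :
    ∫ x, φ x • f x = (∫ x, (φ x).re • f x) + Complex.I • ∫ x, (φ x).im • f x := by
  rw [← integral_smul, ← integral_add hre (him.fun_smul Complex.I)]
  exact integral_congr_ae (.of_forall fun x => complex_smul_eq_re_smul_add_I_smul _ _)

theorem HasL2LineDeriv.integral_fderiv_smul (h : HasL2LineDeriv v f g) {φ : E → ℝ}
    (hφ : ContDiff ℝ ∞ φ) (hc : HasCompactSupport φ) :
    ∫ x, fderiv ℝ φ x v • f x = -∫ x, φ x • g x := by
  let ψ : 𝓢(E, ℂ) := (hc.comp_left Complex.ofReal_zero).toSchwartzMap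
    (Complex.ofRealCLM.contDiff.comp hφ)
  have lineDeriv_ψ x : (∂_{v} ψ) x = (fderiv ℝ φ x v : ℂ) := by
    rw [SchwartzMap.lineDerivOp_apply_eq_fderiv]
    exact congrArg (· v) (Complex.ofRealCLM.hasFDerivAt.comp x
      (hφ.differentiable (by simp) x).hasFDerivAt).fderiv
  have ψ_apply x : ψ x = φ x := rfl
  simpa only [lineDeriv_ψ, ψ_apply, Complex.coe_smul] using h.integral_lineDeriv_smul ψ

theorem hasL2LineDeriv_of_forall_contDiff (hf : MemLp f 2) (hg : MemLp g 2)
    (h : ∀ φ : E → ℝ, ContDiff ℝ ∞ φ → HasCompactSupport φ →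
      ∫ x, fderiv ℝ φ x v • f x = -∫ x, φ x • g x) : HasL2LineDeriv v f g := by
  refine hasL2LineDeriv_of_hasCompactSupport hf hg fun φ hc => ?_
  have contDiff_comp (L : ℂ →L[ℝ] ℝ) : ContDiff ℝ ∞ fun x => L (φ x) :=
    L.contDiff.comp (φ.smooth ⊤)
  have hasCompactSupport_comp (L : ℂ →L[ℝ] ℝ) : HasCompactSupport fun x => L (φ x) :=
    hc.comp_left (map_zero L)
  have integrable_smul_g (L : ℂ →L[ℝ] ℝ) : Integrable fun x => L (φ x) • g x :=
    integrable_smul_of_hasCompactSupport (contDiff_comp L).continuous (hasCompactSupport_comp L) hg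
  have integrable_smul_f (L : ℂ →L[ℝ] ℝ) : Integrable fun x => L ((∂_{v} φ) x) • f x := by
    simp only [clm_lineDeriv_schwartz]
    exact integrable_smul_of_hasCompactSupport
      (((contDiff_comp L).continuous_fderiv (by simp)).clm_apply continuous_const)
      ((hasCompactSupport_comp L).fderiv_apply ℝ v) hf
  have parts (L : ℂ →L[ℝ] ℝ) : ∫ x, L ((∂_{v} φ) x) • f x = -∫ x, L (φ x) • g x := by
    simp only [clm_lineDeriv_schwartz]
    exact h _ (contDiff_comp L) (hasCompactSupport_comp L)
  rw [integral_complex_smul (integrable_smul_f Complex.reCLM) (integrable_smul_f Complex.imCLM),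
    integral_complex_smul (integrable_smul_g Complex.reCLM) (integrable_smul_g Complex.imCLM),
    neg_add, ← smul_neg]
  exact congrArg₂ (· + Complex.I • ·) (parts Complex.reCLM) (parts Complex.imCLM)

end TestFunctions

section Components

variable {ι κ E : Type*}

namespace TwoJet

/-- The two-jet of the `k`-th component of a vector-valued function. -/
def component (J : TwoJet ι E (EuclideanSpace ℂ κ)) (k : κ) : TwoJet ι E ℂ where
  val x := J.val x k
  grad i x := J.grad i x k
  hess i j x := J.hess i j x k

/-- The two-jet of the vector-valued function with prescribed components; it is inverse to
`TwoJet.component`. -/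
def ofComponents (J : κ → TwoJet ι E ℂ) : TwoJet ι E (EuclideanSpace ℂ κ) where
  val x := WithLp.toLp 2 fun k => (J k).val x
  grad i x := WithLp.toLp 2 fun k => (J k).grad i x
  hess i j x := WithLp.toLp 2 fun k => (J k).hess i j x

theorem lap_component [Fintype ι] [Fintype κ] (J : TwoJet ι E (EuclideanSpace ℂ κ)) (k : κ) :
    (J.component k).lap = fun x => J.lap x k := by
  ext x
  simp only [lap, component, Finset.sum_apply, WithLp.ofLp_sum]

end TwoJet

variable [Fintype κ] [NormedAddCommGroup E] [InnerProductSpace ℝ E] [FiniteDimensional ℝ E]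
  [MeasurableSpace E] [BorelSpace E]

theorem hasL2LineDeriv_euclideanSpace_iff {v : E} {f g : E → EuclideanSpace ℂ κ} :
    HasL2LineDeriv v f g ↔ ∀ k, HasL2LineDeriv v (fun x => f x k) (fun x => g x k) := by
  refine ⟨fun h k => h.clm_comp (EuclideanSpace.proj k), fun h => ?_⟩
  have hf : MemLp f 2 := .of_eval_piLp fun k => (h k).memLp
  have hg : MemLp g 2 := .of_eval_piLp fun k => (h k).memLp_deriv
  refine ⟨hf, hg, fun φ => ?_⟩
  ext k
  rw [PiLp.neg_apply,
    eval_integral_piLp fun l => integrable_schwartz_smul _ (h l).memLp,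
    eval_integral_piLp fun l => integrable_schwartz_smul _ (h l).memLp_deriv]
  exact (h k).integral_lineDeriv_smul φ

theorem lpNorm_two_sq_eq_sum {α : Type*} [MeasurableSpace α] {μ : Measure α} {G : κ → Type*}
    [∀ k, NormedAddCommGroup (G k)] {f : α → PiLp 2 G} (hf : MemLp f 2 μ) :
    lpNorm f 2 μ ^ 2 = ∑ k, lpNorm (fun x => f x k) 2 μ ^ 2 := by
  have hfk k : MemLp (fun x => f x k) 2 μ := hf.eval_piLp k
  simp only [lpNorm_ofNat_pow 2 hf.1, lpNorm_ofNat_pow 2 (hfk _).1, PiLp.norm_sq_eq_of_L2]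
  exact integral_finsetSum _ fun k _ => (hfk k).integrable_norm_pow two_ne_zero

namespace TwoJet

variable [Fintype ι] {b : OrthonormalBasis ι ℝ E} {J : TwoJet ι E (EuclideanSpace ℂ κ)}

theorem isH2_iff_component : J.IsH2 b ↔ ∀ k, (J.component k).IsH2 b :=
  ⟨fun h k => ⟨h.memLp.eval_piLp k,
      fun i => hasL2LineDeriv_euclideanSpace_iff.1 (h.hasL2LineDeriv_val i) k,
      fun i j => hasL2LineDeriv_euclideanSpace_iff.1 (h.hasL2LineDeriv_grad i j) k⟩,
    fun h => ⟨.of_eval_piLp fun k => (h k).memLp,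
      fun i => hasL2LineDeriv_euclideanSpace_iff.2 fun k => (h k).hasL2LineDeriv_val i,
      fun i j => hasL2LineDeriv_euclideanSpace_iff.2 fun k => (h k).hasL2LineDeriv_grad i j⟩⟩

theorem IsH2.h2Norm_sq_eq_sum (h : J.IsH2 b) : J.h2Norm ^ 2 = ∑ k, (J.component k).h2Norm ^ 2 := by
  simp only [h2Norm, Real.sq_sqrt (add_nonneg (sq_nonneg _) (sq_nonneg _)), lap_component]
  rw [lpNorm_two_sq_eq_sum h.memLp, lpNorm_two_sq_eq_sum h.memLp_lap, ← Finset.sum_add_distrib]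
  rfl

end TwoJet

end Components

section WeakDerivatives

variable {f g : R3 → ℂ}

theorem IsTestFunction.fderiv_apply {φ : R3 → ℝ} (hφ : IsTestFunction φ) (v : R3) :
    IsTestFunction fun x => fderiv ℝ φ x v :=
  ⟨(hφ.1.fderiv_right (by simp)).clm_apply contDiff_const, hφ.2.fderiv_apply ℝ v⟩

theorem IsTestFunction.laplacian_eq_sum {φ : R3 → ℝ} (hφ : IsTestFunction φ) {ι : Type*}
    [Fintype ι] (b : OrthonormalBasis ι ℝ R3) (x : R3) :
    Laplacian.laplacian φ x = ∑ i, fderiv ℝ (fun y => fderiv ℝ φ y (b i)) x (b i) := by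
  rw [InnerProductSpace.laplacian_eq_iteratedFDeriv_orthonormalBasis φ b]
  refine Finset.sum_congr rfl fun i _ => ?_
  have differentiableAt_fderiv : DifferentiableAt ℝ (fderiv ℝ φ) x :=
    (hφ.1.fderiv_right (m := 1) (by norm_cast)).differentiable one_ne_zero x
  rw [iteratedFDeriv_two_apply,
    fderiv_clm_apply differentiableAt_fderiv (differentiableAt_const _)]
  simp

theorem isWeakPartial_iff_hasL2LineDeriv (hf : MemLp f 2) (hg : MemLp g 2) {i : Fin 3} :
    IsWeakPartial i f g ↔ HasL2LineDeriv (EuclideanSpace.basisFun (Fin 3) ℝ i) f g := by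
  rw [EuclideanSpace.basisFun_apply]
  exact ⟨fun h => hasL2LineDeriv_of_forall_contDiff hf hg fun φ hφ hc => h.2.2 φ ⟨hφ, hc⟩,
    fun h => ⟨hf.locallyIntegrable one_le_two, hg.locallyIntegrable one_le_two,
      fun φ hφ => h.integral_fderiv_smul hφ.1 hφ.2⟩⟩

theorem memH2_iff_exists_isH2 :
    MemH2 f ↔
      ∃ J : TwoJet (Fin 3) R3 ℂ, J.IsH2 (EuclideanSpace.basisFun (Fin 3) ℝ) ∧ J.val = f := by
  constructor
  · rintro ⟨hf, g, h, hg, hh⟩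
    exact ⟨⟨f, g, h⟩, ⟨hf, fun i => (isWeakPartial_iff_hasL2LineDeriv hf (hg i).1).1 (hg i).2,
      fun i j => (isWeakPartial_iff_hasL2LineDeriv (hg i).1 (hh i j).1).1 (hh i j).2⟩, rfl⟩
  · rintro ⟨J, h, rfl⟩
    exact ⟨h.memLp, J.grad, J.hess,
      fun i => ⟨h.memLp_grad i, (isWeakPartial_iff_hasL2LineDeriv h.memLp (h.memLp_grad i)).2
        (h.hasL2LineDeriv_val i)⟩,
      fun i j => ⟨h.memLp_hess i j, (isWeakPartial_iff_hasL2LineDeriv (h.memLp_grad i)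
        (h.memLp_hess i j)).2 (h.hasL2LineDeriv_grad i j)⟩⟩

theorem IsWeakLaplacian.ae_eq {g' : R3 → ℂ} (h : IsWeakLaplacian f g)
    (h' : IsWeakLaplacian f g') : g =ᵐ[volume] g' :=
  ae_eq_of_integral_contDiff_smul_eq h.2.1 h'.2.1 fun φ hφ hc =>
    (h.2.2 φ ⟨hφ, hc⟩).symm.trans (h'.2.2 φ ⟨hφ, hc⟩)

namespace TwoJet

section Scalar

variable {ι : Type*} [Fintype ι] {b : OrthonormalBasis ι ℝ R3} {J : TwoJet ι R3 ℂ}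

theorem IsH2.isWeakLaplacian (h : J.IsH2 b) : IsWeakLaplacian J.val J.lap := by
  refine ⟨h.memLp.locallyIntegrable one_le_two, h.memLp_lap.locallyIntegrable one_le_two,
    fun φ hφ => ?_⟩
  have hφi i := hφ.fderiv_apply (b i)
  have hφii i := (hφi i).fderiv_apply (b i)
  simp only [hφ.laplacian_eq_sum b, lap, Finset.sum_apply, Finset.sum_smul, Finset.smul_sum]
  rw [integral_finsetSum _ fun i _ =>
      integrable_smul_of_hasCompactSupport (hφii i).1.continuous (hφii i).2 h.memLp,
    integral_finsetSum _ fun i _ =>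
      integrable_smul_of_hasCompactSupport hφ.1.continuous hφ.2 (h.memLp_hess i i)]
  refine Finset.sum_congr rfl fun i _ => ?_
  rw [(h.hasL2LineDeriv_val i).integral_fderiv_smul (hφi i).1 (hφi i).2,
    (h.hasL2LineDeriv_grad i i).integral_fderiv_smul hφ.1 hφ.2, neg_neg]

theorem IsH2.weakLaplacian_ae_eq (h : J.IsH2 b) : weakLaplacian J.val =ᵐ[volume] J.lap := by
  have exists_isWeakLaplacian : ∃ g, IsWeakLaplacian J.val g := ⟨_, h.isWeakLaplacian⟩
  rw [weakLaplacian, dif_pos exists_isWeakLaplacian]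
  exact exists_isWeakLaplacian.choose_spec.ae_eq h.isWeakLaplacian

theorem IsH2.normH2_val (h : J.IsH2 b) : normH2 J.val = J.h2Norm := by
  rw [normH2, eLpNorm_congr_ae h.weakLaplacian_ae_eq, toReal_eLpNorm h.memLp.1,
    toReal_eLpNorm h.memLp_lap.1, h2Norm]

end Scalar

variable {N : ℕ}

theorem IsH2.normH2Vec_val {ι : Type*} [Fintype ι] {b : OrthonormalBasis ι ℝ R3}
    {J : TwoJet ι R3 (EuclideanSpace ℂ (Fin N))} (h : J.IsH2 b) : normH2Vec J.val = J.h2Norm := by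
  have normH2_component k : normH2 (fun x => J.val x k) = (J.component k).h2Norm :=
    (isH2_iff_component.1 h k).normH2_val
  simp only [normH2Vec, normH2_component, ← h.h2Norm_sq_eq_sum, Real.sqrt_sq J.h2Norm_nonneg]

end TwoJet

theorem memH2Vec_iff_exists_isH2 {N : ℕ} {ψ : R3 → EuclideanSpace ℂ (Fin N)} :
    MemH2Vec ψ ↔ ∃ J : TwoJet (Fin 3) R3 (EuclideanSpace ℂ (Fin N)),
      J.IsH2 (EuclideanSpace.basisFun (Fin 3) ℝ) ∧ J.val = ψ := by
  simp only [MemH2Vec, memH2_iff_exists_isH2]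
  constructor
  · intro h
    choose J hJ val_J using h
    exact ⟨.ofComponents J, TwoJet.isH2_iff_component.2 hJ,
      funext fun x => PiLp.ext fun k => congrFun (val_J k) x⟩
  · rintro ⟨J, h, rfl⟩ k
    exact ⟨J.component k, TwoJet.isH2_iff_component.1 h k, rfl⟩

end WeakDerivatives

section LocalNonlinearity

open scoped NNReal

section PowerEstimates

variable {V : Type*} [NormedAddCommGroup V] [NormedSpace ℝ V] {b : ℝ}

theorem norm_powerMap_sub_le_add (hb : 0 ≤ b) (z w : V) :
    ‖powerMap b z - powerMap b w‖ ≤ (b + 3) * (‖z‖ ^ b + ‖w‖ ^ b) * ‖z - w‖ := by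
  have max_rpow_le : max ‖z‖ ‖w‖ ^ b ≤ ‖z‖ ^ b + ‖w‖ ^ b := by
    rcases max_choice ‖z‖ ‖w‖ with h | h <;> rw [h]
    exacts [le_add_of_nonneg_right (by positivity), le_add_of_nonneg_left (by positivity)]
  refine (norm_powerMap_sub_le hb (le_max_left ‖z‖ ‖w‖) (le_max_right _ _)).trans ?_
  gcongr

theorem memLp_powerMap_comp {α : Type*} [MeasurableSpace α] {μ : Measure α} {p : ℝ≥0∞} {f : α → V}
    {M : ℝ} (hb : 0 ≤ b) (hf : MemLp f p μ) (hM : ∀ᵐ x ∂μ, ‖f x‖ ≤ M) :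
    MemLp (fun x => powerMap b (f x)) p μ := by
  refine hf.of_le_mul (c := M ^ b)
    ((hf.1.norm.aemeasurable.pow_const b).aestronglyMeasurable.smul hf.1) ?_
  filter_upwards [hM] with x hx
  rw [powerMap, norm_smul, Real.norm_of_nonneg (by positivity)]
  gcongr

theorem rpow_sum_le_card_rpow_mul_sum_rpow {ι : Type*} {t : Finset ι} (ht : t.Nonempty)
    {a : ι → ℝ} (ha : ∀ i ∈ t, 0 ≤ a i) {s : ℝ} (hs : 0 ≤ s) :
    (∑ i ∈ t, a i) ^ s ≤ (t.card : ℝ) ^ max (s - 1) 0 * ∑ i ∈ t, a i ^ s := by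
  rcases le_total 1 s with h | h
  · rw [max_eq_left (sub_nonneg.2 h)]
    exact Real.rpow_sum_le_const_mul_sum_rpow_of_nonneg t h ha
  · rw [max_eq_right (sub_nonpos.2 h), Real.rpow_zero, one_mul]
    exact t.le_sum_nonempty_of_subadditive_on_pred (· ^ s) (0 ≤ ·)
      (fun x y hx hy => Real.rpow_add_le_add_rpow hx hy hs h) (fun x y => add_nonneg) a ht ha

theorem norm_rpow_le_card_rpow_mul_sum {κ : Type*} [Fintype κ] [Nonempty κ] {G : κ → Type*}
    [∀ k, NormedAddCommGroup (G k)] (z : PiLp 2 G) {s : ℝ} (hs : 0 ≤ s) :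
    ‖z‖ ^ (2 * s) ≤ (Fintype.card κ : ℝ) ^ max (s - 1) 0 * ∑ k, ‖z k‖ ^ (2 * s) := by
  simp only [Real.rpow_mul (norm_nonneg _), Real.rpow_two, PiLp.norm_sq_eq_of_L2]
  exact rpow_sum_le_card_rpow_mul_sum_rpow Finset.univ_nonempty (fun k _ => sq_nonneg _) hs

end PowerEstimates

theorem hasLipschitzHessian_smul_powerMap {V : Type*} [NormedAddCommGroup V]
    [InnerProductSpace ℝ V] {b : ℝ} (hb : 2 ≤ b) (c M : ℝ) :
    HasLipschitzHessian (c • powerMap b : V → V) M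
      (‖c‖₊ * (b * (b - 1) * (b + 7) * M ^ (b - 2)).toNNReal) :=
  (hasLipschitzHessian_powerMap hb M).const_smul c

theorem TwoJet.IsH2.h2Norm_comp_smul_powerMap_sub_le {ι E V : Type*} [Fintype ι]
    [NormedAddCommGroup E] [InnerProductSpace ℝ E] [FiniteDimensional ℝ E] [MeasurableSpace E]
    [BorelSpace E] [NormedAddCommGroup V] [InnerProductSpace ℂ V] [CompleteSpace V]
    {e : OrthonormalBasis ι ℝ E} {J J' : TwoJet ι E V} (hE : Module.finrank ℝ E ≤ 3)
    (h : J.IsH2 e) (h' : J'.IsH2 e) {s : ℝ} (hs : J.h2Norm ≤ s) (hs' : J'.h2Norm ≤ s) {b : ℝ}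
    (hb : 2 ≤ b) (c : ℝ) :
    (comp (c • powerMap b) J - comp (c • powerMap b) J').h2Norm ≤
      (1 + 5 * Fintype.card ι) * |c| * (b * (b - 1) * (b + 7)) * sobolevConst E *
        (sobolevConst E * s) ^ b * (J - J').h2Norm := by
  let : InnerProductSpace ℝ V := .rclikeToReal ℂ V
  have hR : 0 ≤ sobolevConst E * s :=
    mul_nonneg sobolevConst_pos.le (J.h2Norm_nonneg.trans hs)
  have hκ : 0 ≤ b * (b - 1) * (b + 7) * (sobolevConst E * s) ^ (b - 2) := by
    have : 0 ≤ b - 1 := by linarith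
    positivity
  have rpow_split : (sobolevConst E * s) ^ b =
      (sobolevConst E * s) ^ (b - 2) * (sobolevConst E * s) ^ 2 := by
    rw [← Real.rpow_add_natCast' hR (by push_cast; linarith), Nat.cast_ofNat, sub_add_cancel]
  refine (h.h2Norm_comp_sub_le hE h' hs hs'
    (hasLipschitzHessian_smul_powerMap hb c _)).trans_eq ?_
  rw [NNReal.coe_mul, coe_nnnorm, Real.norm_eq_abs, Real.coe_toNNReal _ hκ, rpow_split]
  ring

variable {N : ℕ} {ψ ψ' : R3 → EuclideanSpace ℂ (Fin N)} {q : ℝ}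

theorem localNonlinearity_eq_smul_powerMap (q lam : ℝ) (ψ : R3 → EuclideanSpace ℂ (Fin N)) :
    localNonlinearity q lam ψ = fun x => (lam • powerMap (2 * (q - 1))) (ψ x) := by
  ext1 x
  rw [localNonlinearity, exchangePotential, density, ← EuclideanSpace.norm_sq_eq, Pi.smul_apply,
    powerMap, smul_smul, Real.rpow_mul (norm_nonneg _), Real.rpow_two]

theorem normH2_nonneg (f : R3 → ℂ) : 0 ≤ normH2 f := Real.sqrt_nonneg _

theorem finrank_R3_le : Module.finrank ℝ R3 ≤ 3 := finrank_euclideanSpace_fin.le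

theorem MemH2.norm_le {f : R3 → ℂ} (hf : MemH2 f) : ∀ᵐ x, ‖f x‖ ≤ sobolevConst R3 * normH2 f := by
  obtain ⟨J, h, rfl⟩ := memH2_iff_exists_isH2.1 hf
  rw [h.normH2_val]
  exact (h.hasSobolevBound finrank_R3_le).norm_val_le

theorem MemH2Vec.norm_le (hψ : MemH2Vec ψ) : ∀ᵐ x, ‖ψ x‖ ≤ sobolevConst R3 * normH2Vec ψ := by
  obtain ⟨J, h, rfl⟩ := memH2Vec_iff_exists_isH2.1 hψ
  rw [h.normH2Vec_val]
  exact (h.hasSobolevBound finrank_R3_le).norm_val_le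

theorem memLp_localNonlinearity (hq : 1 ≤ q) (lam : ℝ) {p : ℝ≥0∞} (h : MemH2Vec ψ)
    (hψ : MemLp ψ p) : MemLp (localNonlinearity q lam ψ) p := by
  rw [localNonlinearity_eq_smul_powerMap]
  exact (memLp_powerMap_comp (by linarith) hψ h.norm_le).const_smul lam

theorem MemH2Vec.norm_rpow_le [Nonempty (Fin N)] (hq : 1 ≤ q) (h : MemH2Vec ψ) :
    ∀ᵐ x, ‖ψ x‖ ^ (2 * (q - 1)) ≤ sobolevConst R3 ^ (2 * (q - 1)) *
      ((N : ℝ) ^ max (q - 2) 0 * ∑ j, normH2 (fun x => ψ x j) ^ (2 * (q - 1))) := by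
  have hC := (sobolevConst_pos (E := R3)).le
  filter_upwards [ae_all_iff.2 fun j => (h j).norm_le] with x hx
  calc
    ‖ψ x‖ ^ (2 * (q - 1)) ≤ (N : ℝ) ^ max (q - 2) 0 * ∑ j, ‖ψ x j‖ ^ (2 * (q - 1)) := by
      simpa only [Fintype.card_fin, sub_sub, one_add_one_eq_two] using
        norm_rpow_le_card_rpow_mul_sum (ψ x) (sub_nonneg.2 hq)
    _ ≤ (N : ℝ) ^ max (q - 2) 0 *
        ∑ j, (sobolevConst R3 * normH2 (fun x => ψ x j)) ^ (2 * (q - 1)) := by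
      have : 0 ≤ 2 * (q - 1) := by linarith
      gcongr with j
      exact hx j
    _ = _ := by
      simp only [Real.mul_rpow hC (normH2_nonneg _), ← Finset.mul_sum]
      ring

/-- The Lipschitz constant `C_{q,λ}` on `L^p`. The factor `|λ| + 1` instead of `|λ|` keeps it
positive for `λ = 0`. -/
noncomputable def lipschitzConst (q lam : ℝ) : ℝ :=
  (|lam| + 1) * (2 * (q - 1) + 3) * sobolevConst R3 ^ (2 * (q - 1))

theorem lipschitzConst_pos (hq : 1 ≤ q) (lam : ℝ) : 0 < lipschitzConst q lam := by
  have := sobolevConst_pos (E := R3)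
  have : 0 ≤ q - 1 := sub_nonneg.2 hq
  unfold lipschitzConst
  positivity

theorem norm_localNonlinearity_sub_le (hq : 1 ≤ q) (lam : ℝ) (h : MemH2Vec ψ)
    (h' : MemH2Vec ψ') :
    ∀ᵐ x, ‖localNonlinearity q lam ψ x - localNonlinearity q lam ψ' x‖ ≤
      lipschitzConst q lam * (N : ℝ) ^ max (q - 2) 0 *
        (∑ j, (normH2 (fun x => ψ x j) ^ (2 * (q - 1)) +
          normH2 (fun x => ψ' x j) ^ (2 * (q - 1)))) * ‖ψ x - ψ' x‖ := by
  rcases isEmpty_or_nonempty (Fin N) with hN | hN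
  · refine ae_of_all _ fun x => ?_
    rw [Subsingleton.elim (ψ x - ψ' x) 0, norm_zero, mul_zero,
      Subsingleton.elim (_ - _) (0 : EuclideanSpace ℂ (Fin N)), norm_zero]
  have hb : 0 ≤ 2 * (q - 1) := by linarith
  filter_upwards [h.norm_rpow_le hq, h'.norm_rpow_le hq] with x hx hx'
  simp only [localNonlinearity_eq_smul_powerMap, Pi.smul_apply, ← smul_sub]
  calc
    ‖lam • (powerMap (2 * (q - 1)) (ψ x) - powerMap (2 * (q - 1)) (ψ' x))‖
      ≤ (|lam| + 1) * ((2 * (q - 1) + 3) *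
          (‖ψ x‖ ^ (2 * (q - 1)) + ‖ψ' x‖ ^ (2 * (q - 1))) * ‖ψ x - ψ' x‖) := by
        rw [norm_smul, Real.norm_eq_abs]
        gcongr
        exacts [le_add_of_nonneg_right zero_le_one, norm_powerMap_sub_le_add hb _ _]
    _ ≤ _ := by
        grw [hx, hx']
        rw [lipschitzConst, Finset.sum_add_distrib]
        exact (by ring : _ = _).le

theorem normLp_localNonlinearity_sub_le (hq : 1 ≤ q) (lam : ℝ) {p : ℝ≥0∞} (h : MemH2Vec ψ)
    (h' : MemH2Vec ψ') (hψ : MemLp ψ p) (hψ' : MemLp ψ' p) :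
    normLp p (fun x => localNonlinearity q lam ψ x - localNonlinearity q lam ψ' x) ≤
      lipschitzConst q lam * (N : ℝ) ^ max (q - 2) 0 *
        (∑ j, (normH2 (fun x => ψ x j) ^ (2 * (q - 1)) +
          normH2 (fun x => ψ' x j) ^ (2 * (q - 1)))) * normLp p (fun x => ψ x - ψ' x) := by
  refine (ENNReal.toReal_mono (ENNReal.mul_ne_top ENNReal.ofReal_ne_top (hψ.sub hψ').2.ne)
    (eLpNorm_le_mul_eLpNorm_of_ae_le_mul (norm_localNonlinearity_sub_le hq lam h h') p)).trans_eq ?_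
  rw [ENNReal.toReal_mul, ENNReal.toReal_ofReal]
  · rfl
  have := (lipschitzConst_pos hq lam).le
  exact mul_nonneg (by positivity) (Finset.sum_nonneg fun j _ =>
    add_nonneg (Real.rpow_nonneg (normH2_nonneg _) _) (Real.rpow_nonneg (normH2_nonneg _) _))

theorem isH2_comp_smul_powerMap {J : TwoJet (Fin 3) R3 (EuclideanSpace ℂ (Fin N))}
    {e : OrthonormalBasis (Fin 3) ℝ R3} (hq : 2 ≤ q) (lam : ℝ) (h : J.IsH2 e) :
    (TwoJet.comp (lam • powerMap (2 * (q - 1))) J).IsH2 e :=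
  TwoJet.isH2_comp finrank_R3_le h fun M =>
    ⟨_, hasLipschitzHessian_smul_powerMap (by linarith) lam M⟩

theorem memH2Vec_localNonlinearity (hq : 2 ≤ q) (lam : ℝ) (hψ : MemH2Vec ψ) :
    MemH2Vec (localNonlinearity q lam ψ) := by
  obtain ⟨J, h, rfl⟩ := memH2Vec_iff_exists_isH2.1 hψ
  rw [localNonlinearity_eq_smul_powerMap]
  exact memH2Vec_iff_exists_isH2.2 ⟨_, isH2_comp_smul_powerMap hq lam h, rfl⟩

/-- The Lipschitz modulus `𝓛_{q,λ}` on `H²`. The factor `|λ| + 1` instead of `|λ|` makes it vanish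
only at the origin even for `λ = 0`. -/
noncomputable def lipschitzModulus (q lam s : ℝ) : ℝ :=
  16 * (|lam| + 1) * (2 * (q - 1) * (2 * (q - 1) - 1) * (2 * (q - 1) + 7)) * sobolevConst R3 *
    (sobolevConst R3 * s) ^ (2 * (q - 1))

theorem lipschitzModulus_eq_zero_iff (hq : 2 ≤ q) (lam : ℝ) {s : ℝ} (hs : 0 ≤ s) :
    lipschitzModulus q lam s = 0 ↔ s = 0 := by
  have hC := sobolevConst_pos (E := R3)
  have hb : 0 < 2 * (q - 1) - 1 := by linarith
  have hb' : 0 < q - 1 := by linarith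
  rw [lipschitzModulus, mul_eq_zero_iff_left (by positivity),
    Real.rpow_eq_zero (by positivity) (by positivity), mul_eq_zero_iff_left hC.ne']

theorem monotoneOn_lipschitzModulus (hq : 2 ≤ q) (lam : ℝ) :
    MonotoneOn (lipschitzModulus q lam) (Set.Ici 0) := by
  intro s (hs : 0 ≤ s) t _ hst
  have hC := sobolevConst_pos (E := R3)
  have hb : 0 ≤ 2 * (q - 1) - 1 := by linarith
  have hb' : 0 ≤ q - 1 := by linarith
  unfold lipschitzModulus
  gcongr

theorem lipschitzModulus_nonneg (hq : 2 ≤ q) (lam : ℝ) {s : ℝ} (hs : 0 ≤ s) :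
    0 ≤ lipschitzModulus q lam s :=
  ((lipschitzModulus_eq_zero_iff hq lam le_rfl).2 rfl).symm.trans_le
    (monotoneOn_lipschitzModulus hq lam Set.self_mem_Ici hs hs)

theorem normH2Vec_localNonlinearity_sub_le (hq : 2 ≤ q) (lam : ℝ) (hψ : MemH2Vec ψ)
    (hψ' : MemH2Vec ψ') :
    normH2Vec (fun x => localNonlinearity q lam ψ x - localNonlinearity q lam ψ' x) ≤
      lipschitzModulus q lam (max (normH2Vec ψ) (normH2Vec ψ')) *
        normH2Vec (fun x => ψ x - ψ' x) := by
  obtain ⟨J, h, rfl⟩ := memH2Vec_iff_exists_isH2.1 hψ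
  obtain ⟨J', h', rfl⟩ := memH2Vec_iff_exists_isH2.1 hψ'
  have hb : 2 ≤ 2 * (q - 1) := by linarith
  have hC := sobolevConst_pos (E := R3)
  have hs : 0 ≤ max J.h2Norm J'.h2Norm := le_max_of_le_left J.h2Norm_nonneg
  have key := h.h2Norm_comp_smul_powerMap_sub_le finrank_R3_le h' (le_max_left _ J'.h2Norm)
    (le_max_right _ _) hb lam
  have normH2Vec_sub : normH2Vec (fun x => J.val x - J'.val x) = (J - J').h2Norm :=
    (h.sub h').normH2Vec_val
  rw [localNonlinearity_eq_smul_powerMap, localNonlinearity_eq_smul_powerMap, normH2Vec_sub,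
    h.normH2Vec_val, h'.normH2Vec_val]
  refine (((isH2_comp_smul_powerMap hq lam h).sub
    (isH2_comp_smul_powerMap hq lam h')).normH2Vec_val.trans_le key).trans ?_
  have hb' : 0 ≤ 2 * (q - 1) - 1 := by linarith
  have := (J - J').h2Norm_nonneg
  rw [lipschitzModulus, Fintype.card_fin]
  gcongr
  · norm_num
  · exact le_add_of_nonneg_right zero_le_one

end LocalNonlinearity

theorem mainTheorem2_general :
    (∀ q lam : ℝ, 1 ≤ q →
      ∃ C : ℝ, 0 < C ∧
        ∀ (N : ℕ) (p : ℝ≥0∞) (ψ ψ' : R3 → EuclideanSpace ℂ (Fin N)),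
          MemH2Vec ψ → MemLp ψ p volume → MemH2Vec ψ' → MemLp ψ' p volume →
          MemLp (localNonlinearity q lam ψ) p volume ∧
          MemLp (localNonlinearity q lam ψ') p volume ∧
          normLp p (fun x => localNonlinearity q lam ψ x - localNonlinearity q lam ψ' x) ≤
            C * (N : ℝ) ^ max (q - 2) 0 *
              (∑ j, (normH2 (fun x => ψ x j) ^ (2 * (q - 1)) +
                normH2 (fun x => ψ' x j) ^ (2 * (q - 1)))) *
              normLp p (fun x => ψ x - ψ' x)) ∧
    (∀ q lam : ℝ, 2 ≤ q →
      ∃ L : ℝ → ℝ, MonotoneOn L (Set.Ici 0) ∧ (∀ s, 0 ≤ s → 0 ≤ L s) ∧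
        (∀ s, 0 ≤ s → (L s = 0 ↔ s = 0)) ∧
        ∀ (N : ℕ) (ψ ψ' : R3 → EuclideanSpace ℂ (Fin N)),
          MemH2Vec ψ → MemH2Vec ψ' →
          MemH2Vec (localNonlinearity q lam ψ) ∧
          MemH2Vec (localNonlinearity q lam ψ') ∧
          normH2Vec (fun x => localNonlinearity q lam ψ x - localNonlinearity q lam ψ' x) ≤
            L (max (normH2Vec ψ) (normH2Vec ψ')) * normH2Vec (fun x => ψ x - ψ' x)) := by
  constructor
  · intro q lam hq
    exact ⟨lipschitzConst q lam, lipschitzConst_pos hq lam, fun N p ψ ψ' h hψ h' hψ' =>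
      ⟨memLp_localNonlinearity hq lam h hψ, memLp_localNonlinearity hq lam h' hψ',
        normLp_localNonlinearity_sub_le hq lam h h' hψ hψ'⟩⟩
  · intro q lam hq
    exact ⟨lipschitzModulus q lam, monotoneOn_lipschitzModulus hq lam,
      fun s => lipschitzModulus_nonneg hq lam, fun s => lipschitzModulus_eq_zero_iff hq lam,
      fun N ψ ψ' h h' => ⟨memH2Vec_localNonlinearity hq lam h, memH2Vec_localNonlinearity hq lam h',
        normH2Vec_localNonlinearity_sub_le hq lam h h'⟩⟩

theorem mainTheorem2 :
    (∀ q lam : ℝ, 1 ≤ q →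
      ∃ C : ℝ, 0 < C ∧
        ∀ (N : ℕ) (p : ℝ≥0∞), 1 ≤ p →
        ∀ ψ ψ' : R3 → EuclideanSpace ℂ (Fin N),
          MemH2Vec ψ → MemLp ψ p volume → MemH2Vec ψ' → MemLp ψ' p volume →
          MemLp (localNonlinearity q lam ψ) p volume ∧
          MemLp (localNonlinearity q lam ψ') p volume ∧
          normLp p (fun x => localNonlinearity q lam ψ x - localNonlinearity q lam ψ' x) ≤
            C * (N : ℝ) ^ max (q - 2) 0 *
              (∑ j, (normH2 (fun x => ψ x j) ^ (2 * (q - 1)) +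
                normH2 (fun x => ψ' x j) ^ (2 * (q - 1)))) *
              normLp p (fun x => ψ x - ψ' x)) ∧
    (∀ q lam : ℝ, 7 / 2 ≤ q →
      ∃ L : ℝ → ℝ, MonotoneOn L (Set.Ici 0) ∧ (∀ s, 0 ≤ s → 0 ≤ L s) ∧
        (∀ s, 0 ≤ s → (L s = 0 ↔ s = 0)) ∧
        ∀ (N : ℕ) (ψ ψ' : R3 → EuclideanSpace ℂ (Fin N)),
          MemH2Vec ψ → MemH2Vec ψ' →
          MemH2Vec (localNonlinearity q lam ψ) ∧
          MemH2Vec (localNonlinearity q lam ψ') ∧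
          normH2Vec (fun x => localNonlinearity q lam ψ x - localNonlinearity q lam ψ' x) ≤
            L (max (normH2Vec ψ) (normH2Vec ψ')) * normH2Vec (fun x => ψ x - ψ' x)) := by
  exact ⟨fun q lam hq => (mainTheorem2_general.1 q lam hq).imp fun _ ⟨hC, h⟩ =>
    ⟨hC, fun N p _ => h N p⟩, fun q lam hq => mainTheorem2_general.2 q lam (by linarith)⟩
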